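/- Let $n\ge 4$ and let $N=I\times M^\star$ be a doubly warped spacetime of dimension $n$: $I\subseteq\mathbb R$ is open, $(M^\star,g^\star)$ is a smooth Riemannian manifold of dimension $n-1$, and $N$ carries the Lorentzian metric $$ds^2=g_{ij}dx^idx^j=-b^2(\mathbf x)\,dt^2+a^2(t)\,g^\star_{\mu\nu}(\mathbf x)\,dx^\mu dx^\nu$$ with smooth positive functions $a$ on $I$ and $b$ on $M^\star$. Let $\nabla$ be the Levi-Civita connection of $g$, let $u=b^{-1}\partial_t$ be the comoving unit time-like vector field, let $\dot X=u^k\nabla_kX$ denote the derivative along $u$, so that $\dot u_j=u^k\nabla_ku_j$, and let $\varphi=\frac{1}{n-1}\nabla_ju^j$, so that $\nabla_iu_j=\varphi(g_{ij}+u_iu_j)-u_i\dot u_j$. Let $C_{jklm}$ be the Weyl tensor of $g$ and $E_{kl}=u^ju^mC_{jklm}$ its electric part. Suppose that the Weyl tensor is harmonic on $N$, i.e. $\nabla_mC_{jkl}{}^m=0$. Then at every point of $N$ where $\varphi^2+\dot\varphi\neq 0$ (hence on all of $N$, if $\varphi^2+\dot\varphi$ vanishes nowhere): 1. $C_{jklm}u^m=0$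 and $C_{jklm}\dot u^m=0$; 2. if $n=4$, then $C_{jklm}=0$; 3. $E_{ij}=0$. -/

import Mathlib

open scoped ContDiff Manifold

noncomputable section

/-! Tensor calculus in a coordinate domain of `ℝⁿ`.  A metric is given by its matrix of components
`g p i j`; every tensor is given by its components.  Derivatives are only taken at points of an
open set on which the fields are smooth and `g` is nondegenerate. -/

namespace CoordGeometry

variable {n : ℕ}

/-- The partial derivative `∂ᵢ f` at `p`. -/
def partialDeriv (i : Fin n) (f : (Fin n → ℝ) → ℝ) (p : Fin n → ℝ) : ℝ :=
  fderiv ℝ f p (Pi.single i 1)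

/-- `christoffel g i j k p` is
`Γᵢⱼᵏ = ½ gᵏˡ (∂ᵢ gⱼₗ + ∂ⱼ gᵢₗ - ∂ₗ gᵢⱼ)`, the last index being the upper one. -/
def christoffel (g : (Fin n → ℝ) → Matrix (Fin n) (Fin n) ℝ) (i j k : Fin n)
    (p : Fin n → ℝ) : ℝ :=
  (1 / 2) * ∑ l, (g p)⁻¹ k l *
    (partialDeriv i (fun q => g q j l) p + partialDeriv j (fun q => g q i l) p
      - partialDeriv l (fun q => g q i j) p)

/-- `riemannUp g j k l m p` is
`Rⱼₖₗᵐ = -∂ⱼ Γₖₗᵐ + ∂ₖ Γⱼₗᵐ + Γⱼₗᵖ Γₖₚᵐ - Γₖₗᵖ Γⱼₚᵐ`,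
so that `[∇ⱼ, ∇ₖ] uₗ = Rⱼₖₗᵐ uₘ`. -/
def riemannUp (g : (Fin n → ℝ) → Matrix (Fin n) (Fin n) ℝ) (j k l m : Fin n)
    (p : Fin n → ℝ) : ℝ :=
  - partialDeriv j (christoffel g k l m) p + partialDeriv k (christoffel g j l m) p
    + ∑ r, (christoffel g j l r p * christoffel g k r m p
      - christoffel g k l r p * christoffel g j r m p)

/-- `Rⱼₖₗₘ = gₘᵣ Rⱼₖₗʳ`. -/
def riemann (g : (Fin n → ℝ) → Matrix (Fin n) (Fin n) ℝ) (j k l m : Fin n)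
    (p : Fin n → ℝ) : ℝ :=
  ∑ r, g p m r * riemannUp g j k l r p

/-- The Ricci tensor `Rₖₗ = Rₖₘₗᵐ = ∂ₘ Γₖₗᵐ - ∂ₖ Γₘₗᵐ + ⋯`. -/
def ricci (g : (Fin n → ℝ) → Matrix (Fin n) (Fin n) ℝ) (k l : Fin n) (p : Fin n → ℝ) : ℝ :=
  ∑ m, riemannUp g k m l m p

/-- The scalar curvature `R = gᵏˡ Rₖₗ`. -/
def scalarCurvature (g : (Fin n → ℝ) → Matrix (Fin n) (Fin n) ℝ) (p : Fin n → ℝ) : ℝ :=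
  ∑ k, ∑ l, (g p)⁻¹ k l * ricci g k l p

/-- The Weyl tensor `Cⱼₖₗₘ`, all indices down (for `n ≥ 3`). -/
def weyl (g : (Fin n → ℝ) → Matrix (Fin n) (Fin n) ℝ) (j k l m : Fin n)
    (p : Fin n → ℝ) : ℝ :=
  riemann g j k l m p
    + (g p j m * ricci g k l p - g p k m * ricci g j l p
        + ricci g j m p * g p k l - ricci g k m p * g p j l) / ((n : ℝ) - 2)
    - scalarCurvature g p * (g p j m * g p k l - g p k m * g p j l)
        / (((n : ℝ) - 1) * ((n : ℝ) - 2))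

/-- `Cⱼₖₗᵐ = gᵐʳ Cⱼₖₗᵣ`. -/
def weylUp (g : (Fin n → ℝ) → Matrix (Fin n) (Fin n) ℝ) (j k l m : Fin n)
    (p : Fin n → ℝ) : ℝ :=
  ∑ r, (g p)⁻¹ m r * weyl g j k l r p

/-- The covariant derivative `∇ᵢ Tⱼₖₗᵐ` of a tensor field `T` with three lower indices and one
upper index. -/
def covDerivTensor (g : (Fin n → ℝ) → Matrix (Fin n) (Fin n) ℝ)
    (T : Fin n → Fin n → Fin n → Fin n → (Fin n → ℝ) → ℝ) (i j k l m : Fin n)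
    (p : Fin n → ℝ) : ℝ :=
  partialDeriv i (T j k l m) p
    + ∑ r, (christoffel g i r m p * T j k l r p - christoffel g i j r p * T r k l m p
      - christoffel g i k r p * T j r l m p - christoffel g i l r p * T j k r m p)

/-- The divergence `∇ₘ Cⱼₖₗᵐ` of the Weyl tensor. -/
def divWeyl (g : (Fin n → ℝ) → Matrix (Fin n) (Fin n) ℝ) (j k l : Fin n)
    (p : Fin n → ℝ) : ℝ :=
  ∑ m, covDerivTensor g (weylUp g) m j k l m p

/-- The covariant derivative `∇ᵢ uʲ` of a vector field. -/
def covDerivVec (g : (Fin n → ℝ) → Matrix (Fin n) (Fin n) ℝ)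
    (u : (Fin n → ℝ) → Fin n → ℝ) (i j : Fin n) (p : Fin n → ℝ) : ℝ :=
  partialDeriv i (fun q => u q j) p + ∑ k, christoffel g i k j p * u p k

/-- The acceleration `u̇ʲ = uⁱ ∇ᵢ uʲ`. -/
def acceleration (g : (Fin n → ℝ) → Matrix (Fin n) (Fin n) ℝ)
    (u : (Fin n → ℝ) → Fin n → ℝ) (p : Fin n → ℝ) (j : Fin n) : ℝ :=
  ∑ i, u p i * covDerivVec g u i j p

/-- The expansion scalar `φ = ∇ⱼ uʲ / (n - 1)`. -/
def expansion (g : (Fin n → ℝ) → Matrix (Fin n) (Fin n) ℝ)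
    (u : (Fin n → ℝ) → Fin n → ℝ) (p : Fin n → ℝ) : ℝ :=
  (∑ j, covDerivVec g u j j p) / ((n : ℝ) - 1)

/-- The derivative `ḟ = uᵏ ∂ₖ f` of a scalar along `u`. -/
def dot (u : (Fin n → ℝ) → Fin n → ℝ) (f : (Fin n → ℝ) → ℝ) (p : Fin n → ℝ) : ℝ :=
  ∑ k, u p k * partialDeriv k f p

/-- The electric part `Eₖₗ = uʲ uᵐ Cⱼₖₗₘ` of the Weyl tensor relative to `u`. -/
def electric (g : (Fin n → ℝ) → Matrix (Fin n) (Fin n) ℝ)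
    (u : (Fin n → ℝ) → Fin n → ℝ) (k l : Fin n) (p : Fin n → ℝ) : ℝ :=
  ∑ j, ∑ m, u p j * u p m * weyl g j k l m p

end CoordGeometry

/-- The data of a doubly warped spacetime of dimension `d + 1`: the manifold is `I × M`, with `I`
open in `ℝ` and `(M, gStar)` a smooth Riemannian manifold of dimension `d`, and the Lorentzian
metric is `ds² = -b(x)² dt² + a(t)² gStar(x)`, with smooth positive warping functions `a`, `b`. -/
structure DoublyWarpedSpacetime (d : ℕ) (M : Type*) [TopologicalSpace M]
    [ChartedSpace (EuclideanSpace ℝ (Fin d)) M] [IsManifold (𝓡 d) ∞ M] where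
  /-- The range of the time `t`. -/
  I : Set ℝ
  isOpen_I : IsOpen I
  /-- The scale function of time. -/
  a : ℝ → ℝ
  contDiffOn_a : ContDiffOn ℝ ∞ a I
  a_pos : ∀ t ∈ I, 0 < a t
  /-- The warping function of position. -/
  b : M → ℝ
  contMDiff_b : ContMDiff (𝓡 d) 𝓘(ℝ) ∞ b
  b_pos : ∀ x, 0 < b x
  /-- The Riemannian metric of the space manifold. -/
  gStar : Bundle.ContMDiffRiemannianMetric (𝓡 d) ∞ (EuclideanSpace ℝ (Fin d))
    (fun x : M => TangentSpace (𝓡 d) x)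

namespace DoublyWarpedSpacetime

variable {d : ℕ} {M : Type*} [TopologicalSpace M]
  [ChartedSpace (EuclideanSpace ℝ (Fin d)) M] [IsManifold (𝓡 d) ∞ M]

/-- The Lorentzian metric at the event `(t, x)`, on pairs of tangent vectors
`(τ, v) ∈ T_t ℝ × T_x M`. -/
def metric (S : DoublyWarpedSpacetime d M) (t : ℝ) (x : M)
    (v w : ℝ × TangentSpace (𝓡 d) x) : ℝ :=
  -(S.b x) ^ 2 * (v.1 * w.1) + (S.a t) ^ 2 * S.gStar.inner x v.2 w.2

/-- The space part `(p₁, …, p_d)` of the coordinates `p = (t, p₁, …, p_d)`. -/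
def spacePart (p : Fin (d + 1) → ℝ) : EuclideanSpace ℝ (Fin d) :=
  WithLp.toLp 2 (Fin.tail p)

/-- A chart `e` of `M` gives coordinates `(t, p₁, …, p_d)` on the open set `I × e.source` of the
spacetime; this is the range of these coordinates. -/
def coordDomain (S : DoublyWarpedSpacetime d M)
    (e : OpenPartialHomeomorph M (EuclideanSpace ℝ (Fin d))) : Set (Fin (d + 1) → ℝ) :=
  {p | p 0 ∈ S.I ∧ spacePart p ∈ e.target}

/-- The coordinate frame `∂₀ = ∂/∂t`, `∂_μ` given by the chart `e`. -/
def frame (e : OpenPartialHomeomorph M (EuclideanSpace ℝ (Fin d)))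
    (p : Fin (d + 1) → ℝ) (i : Fin (d + 1)) :
    ℝ × TangentSpace (𝓡 d) (e.symm (spacePart p)) :=
  Fin.cases (1, 0)
    (fun μ => (0, mfderiv (𝓡 d) (𝓡 d) e.symm (spacePart p)
      (EuclideanSpace.single μ (1 : ℝ) : EuclideanSpace ℝ (Fin d)))) i

/-- The components `gᵢⱼ` of the spacetime metric in the coordinates given by `e`. -/
def g (S : DoublyWarpedSpacetime d M)
    (e : OpenPartialHomeomorph M (EuclideanSpace ℝ (Fin d)))
    (p : Fin (d + 1) → ℝ) : Matrix (Fin (d + 1)) (Fin (d + 1)) ℝ :=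
  fun i j => S.metric (p 0) (e.symm (spacePart p)) (frame e p i) (frame e p j)

/-- The components `uⁱ` of the comoving unit vector field `u = b⁻¹ ∂/∂t`. -/
def u (S : DoublyWarpedSpacetime d M)
    (e : OpenPartialHomeomorph M (EuclideanSpace ℝ (Fin d)))
    (p : Fin (d + 1) → ℝ) : Fin (d + 1) → ℝ :=
  Fin.cons (S.b (e.symm (spacePart p)))⁻¹ (fun _ => 0)

/-- The scalar `φ` with `∇ᵢ uⱼ = φ (gᵢⱼ + uᵢ uⱼ) - uᵢ u̇ⱼ`. -/
def φ (S : DoublyWarpedSpacetime d M)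
    (e : OpenPartialHomeomorph M (EuclideanSpace ℝ (Fin d))) : (Fin (d + 1) → ℝ) → ℝ :=
  CoordGeometry.expansion (S.g e) (S.u e)

/-- The Weyl tensor is harmonic: `∇ₘ Cⱼₖₗᵐ = 0` on the whole spacetime, that is, in the
coordinates given by every smooth chart of `M`. -/
def HarmonicWeyl (S : DoublyWarpedSpacetime d M) : Prop :=
  ∀ e ∈ IsManifold.maximalAtlas (𝓡 d) ∞ M, ∀ p ∈ S.coordDomain e,
    ∀ j k l, CoordGeometry.divWeyl (S.g e) j k l p = 0

end DoublyWarpedSpacetime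

end

/-! Work in coordinates `(t, x)` from a chart of the space manifold and put `H = a'/a`. The metric
is block-diagonal, `g₀₀ = -b²` does not depend on time, and the space block is scaled in time at
rate `2H`. Then `φ = H/b` and `φ² + φ̇ = (H² + ∂₀H)/b²` (`φ_eq`, `φ_sq_add_dot`), so the hypothesis
says `H² + ∂₀H ≠ 0`. Write `w_μ = Γ₀μ⁰ = ∂_μ log b`, which is the acceleration with its index
lowered.

Three facts determine the components with a time index. First, `R_{μνρ0}` is built from `w` and the
metric alone, hence is pure trace, and so `C_{μνρ0} = 0` without any assumption on the divergence
(`weyl_sss0`). Second, up to multiples of `g_{μν}` the electric components `C_{0μν}⁰` combine the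
Hessian of `b` divided by `b` with the Ricci tensor of the slice. Both are independent of time, so
`∂₀ C_{0μν}⁰` is a multiple of `g_{μν}`, and trace-freeness makes the multiple zero
(`timeDeriv_weylUp_0ss0`). Third, with these two facts the divergence component `∇ₘ C_{0μν}ᵐ`
collapses to `(d - 2) H C_{0μν}⁰` (`divWeyl_0ss`). A harmonic Weyl tensor therefore gives `H
C_{0μν}⁰ = 0`. Where `H ≠ 0` the electric part vanishes. Where `H = 0`, a time derivative gives `∂₀H
C_{0μν}⁰ = 0` with `∂₀H ≠ 0` (`weylUp_0ss0_eq_zero`).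

For the acceleration, a divergence-free Weyl tensor has zero Cotton tensor in dimension at least
four, hence satisfies the second Bianchi identity itself (`weylUp_second_bianchi`). Every component
with a time index vanishes near the point, so one component of that identity reduces to `w_σ
C_{μνρ}^σ = 0` (`sum_christoffel_mul_weylUp`).

In dimension four the remaining space block is a trace-free tensor of curvature type in dimension
three, hence zero (`curvatureOperator_eq_zero_of_trace`). -/

namespace CoordGeometry
variable {n : ℕ}

/-! ### Partial derivatives of smooth functions on an open set. -/

section Calculus

variable {U : Set (Fin n → ℝ)} {f h : (Fin n → ℝ) → ℝ} {p : Fin n → ℝ}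

theorem partialDeriv_add (i : Fin n) (hf : DifferentiableAt ℝ f p) (hh : DifferentiableAt ℝ h p) :
    partialDeriv i (fun q => f q + h q) p = partialDeriv i f p + partialDeriv i h p := by
  simp only [partialDeriv]
  rw [fderiv_fun_add hf hh]; rfl

theorem partialDeriv_sub (i : Fin n) (hf : DifferentiableAt ℝ f p) (hh : DifferentiableAt ℝ h p) :
    partialDeriv i (fun q => f q - h q) p = partialDeriv i f p - partialDeriv i h p := by
  simp only [partialDeriv]
  rw [fderiv_fun_sub hf hh]; rfl

theorem partialDeriv_neg (i : Fin n) :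
    partialDeriv i (fun q => - f q) p = - partialDeriv i f p := by
  simp only [partialDeriv]
  rw [fderiv_fun_neg]; rfl

theorem partialDeriv_mul (i : Fin n) (hf : DifferentiableAt ℝ f p) (hh : DifferentiableAt ℝ h p) :
    partialDeriv i (fun q => f q * h q) p
      = partialDeriv i f p * h p + f p * partialDeriv i h p := by
  simp only [partialDeriv]
  rw [fderiv_fun_mul hf hh]
  simp only [add_apply, smul_apply, smul_eq_mul]
  ring

theorem partialDeriv_const (i : Fin n) (c : ℝ) : partialDeriv i (fun _ => c) p = 0 := by
  simp [partialDeriv]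

theorem partialDeriv_const_mul (i : Fin n) (c : ℝ) (hf : DifferentiableAt ℝ f p) :
    partialDeriv i (fun q => c * f q) p = c * partialDeriv i f p := by
  rw [partialDeriv_mul i (differentiableAt_const c) hf, partialDeriv_const]; ring

theorem partialDeriv_sum {ι : Type*} (s : Finset ι) {F : ι → (Fin n → ℝ) → ℝ} (i : Fin n)
    (hF : ∀ a ∈ s, DifferentiableAt ℝ (F a) p) :
    partialDeriv i (fun q => ∑ a ∈ s, F a q) p = ∑ a ∈ s, partialDeriv i (F a) p := by
  simp only [partialDeriv]
  rw [fderiv_fun_sum hF]; simp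

theorem partialDeriv_congr (hU : IsOpen U) (hp : p ∈ U) (hfh : ∀ q ∈ U, f q = h q) (i : Fin n) :
    partialDeriv i f p = partialDeriv i h p := by
  have : f =ᶠ[nhds p] h := Filter.eventuallyEq_of_mem (hU.mem_nhds hp) hfh
  simp only [partialDeriv]
  rw [this.fderiv_eq]

theorem partialDeriv_eq_zero (hU : IsOpen U) (hp : p ∈ U) (hf : ∀ q ∈ U, f q = 0) (i : Fin n) :
    partialDeriv i f p = 0 := by
  rw [partialDeriv_congr hU hp hf i, partialDeriv_const]

theorem contDiffOn_partialDeriv (hU : IsOpen U) (hf : ContDiffOn ℝ ∞ f U) (i : Fin n) :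
    ContDiffOn ℝ ∞ (partialDeriv i f) U := by
  have := hf.fderiv_of_isOpen (m := ∞) hU (by simp)
  exact this.clm_apply contDiffOn_const

theorem differentiableAt_of_contDiffOn (hU : IsOpen U) (hp : p ∈ U) (hf : ContDiffOn ℝ ∞ f U) :
    DifferentiableAt ℝ f p :=
  (hf.contDiffAt (hU.mem_nhds hp)).differentiableAt (by simp)

theorem partialDeriv_comm (hU : IsOpen U) (hp : p ∈ U) (hf : ContDiffOn ℝ ∞ f U) (i j : Fin n) :
    partialDeriv i (partialDeriv j f) p = partialDeriv j (partialDeriv i f) p := by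
  have hfp := hf.contDiffAt (hU.mem_nhds hp)
  have hs : IsSymmSndFDerivAt ℝ f p := by
    apply hfp.isSymmSndFDerivAt
    rw [minSmoothness_of_isRCLikeNormedField]
    exact WithTop.coe_le_coe.2 (by exact_mod_cast le_top)
  have hd : DifferentiableAt ℝ (fderiv ℝ f) p :=
    (hfp.fderiv_right (m := ∞) (by simp)).differentiableAt (by simp)
  have key (a b : Fin n) : partialDeriv a (partialDeriv b f) p
      = fderiv ℝ (fderiv ℝ f) p (Pi.single a 1) (Pi.single b 1) := by
    show fderiv ℝ (fun q => fderiv ℝ f q (Pi.single b 1)) p (Pi.single a 1) = _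
    rw [fderiv_clm_apply hd (differentiableAt_const _)]
    simp
  rw [key, key, hs.eq]

end Calculus

/-! ### Entrywise calculus of matrix fields. -/

section MatrixCalculus

variable {U : Set (Fin n → ℝ)} {p : Fin n → ℝ}

/-- The entrywise partial derivative of a field of matrices. -/
noncomputable def partialDerivMatrix (i : Fin n) (A : (Fin n → ℝ) → Matrix (Fin n) (Fin n) ℝ)
    (p : Fin n → ℝ) : Matrix (Fin n) (Fin n) ℝ :=
  fun l m => partialDeriv i (fun q => A q l m) p

/-- A field of matrices whose entries are smooth on `U`. -/
def SmoothMatrixOn (A : (Fin n → ℝ) → Matrix (Fin n) (Fin n) ℝ) (U : Set (Fin n → ℝ)) : Prop :=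
  ∀ l m, ContDiffOn ℝ ∞ (fun q => A q l m) U

variable {A B : (Fin n → ℝ) → Matrix (Fin n) (Fin n) ℝ}

theorem SmoothMatrixOn.mul (hA : SmoothMatrixOn A U) (hB : SmoothMatrixOn B U) :
    SmoothMatrixOn (fun q => A q * B q) U := by
  intro l m
  simp only [Matrix.mul_apply]
  exact ContDiffOn.sum fun r _ => (hA l r).mul (hB r m)

theorem SmoothMatrixOn.sub (hA : SmoothMatrixOn A U) (hB : SmoothMatrixOn B U) :
    SmoothMatrixOn (fun q => A q - B q) U := fun l m => (hA l m).sub (hB l m)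

theorem SmoothMatrixOn.transpose (hA : SmoothMatrixOn A U) :
    SmoothMatrixOn (fun q => (A q).transpose) U := fun l m => hA m l

theorem SmoothMatrixOn.partialDerivMatrix (hU : IsOpen U) (hA : SmoothMatrixOn A U) (i : Fin n) :
    SmoothMatrixOn (partialDerivMatrix i A) U :=
  fun l m => contDiffOn_partialDeriv hU (hA l m) i

theorem SmoothMatrixOn.det (hA : SmoothMatrixOn A U) : ContDiffOn ℝ ∞ (fun q => (A q).det) U := by
  simp only [Matrix.det_apply']
  exact ContDiffOn.sum fun σ _ => contDiffOn_const.mul (contDiffOn_prod fun i _ => hA _ _)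

/-- Cramer's rule: each entry is the inverse of the determinant times the determinant of a matrix
with one row replaced by a constant. -/
theorem SmoothMatrixOn.inv (hA : SmoothMatrixOn A U) (hdet : ∀ q ∈ U, (A q).det ≠ 0) :
    SmoothMatrixOn (fun q => (A q)⁻¹) U := by
  intro l m
  simp only [Matrix.inv_def, Matrix.smul_apply, smul_eq_mul, Ring.inverse_eq_inv',
    Matrix.adjugate_apply]
  refine (hA.det.inv hdet).mul (SmoothMatrixOn.det (A := fun q => (A q).updateRow m _) ?_)
  intro a b
  simp only [Matrix.updateRow_apply]
  split_ifs
  · exact contDiffOn_const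
  · exact hA a b

theorem partialDerivMatrix_add (hU : IsOpen U) (hp : p ∈ U) (hA : SmoothMatrixOn A U)
    (hB : SmoothMatrixOn B U) (i : Fin n) :
    partialDerivMatrix i (fun q => A q + B q) p
      = partialDerivMatrix i A p + partialDerivMatrix i B p := by
  ext l m
  exact partialDeriv_add i (differentiableAt_of_contDiffOn hU hp (hA l m))
    (differentiableAt_of_contDiffOn hU hp (hB l m))

theorem partialDerivMatrix_sub (hU : IsOpen U) (hp : p ∈ U) (hA : SmoothMatrixOn A U)
    (hB : SmoothMatrixOn B U) (i : Fin n) :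
    partialDerivMatrix i (fun q => A q - B q) p
      = partialDerivMatrix i A p - partialDerivMatrix i B p := by
  ext l m
  exact partialDeriv_sub i (differentiableAt_of_contDiffOn hU hp (hA l m))
    (differentiableAt_of_contDiffOn hU hp (hB l m))

theorem partialDerivMatrix_mul (hU : IsOpen U) (hp : p ∈ U) (hA : SmoothMatrixOn A U)
    (hB : SmoothMatrixOn B U) (i : Fin n) :
    partialDerivMatrix i (fun q => A q * B q) p
      = partialDerivMatrix i A p * B p + A p * partialDerivMatrix i B p := by
  ext l m
  simp only [partialDerivMatrix, Matrix.mul_apply, Matrix.add_apply]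
  rw [partialDeriv_sum, ← Finset.sum_add_distrib]
  · refine Finset.sum_congr rfl fun r _ => ?_
    exact partialDeriv_mul i (differentiableAt_of_contDiffOn hU hp (hA l r))
      (differentiableAt_of_contDiffOn hU hp (hB r m))
  · exact fun r _ => (differentiableAt_of_contDiffOn hU hp (hA l r)).mul
      (differentiableAt_of_contDiffOn hU hp (hB r m))

theorem partialDerivMatrix_congr (hU : IsOpen U) (hp : p ∈ U) (hAB : ∀ q ∈ U, A q = B q)
    (i : Fin n) : partialDerivMatrix i A p = partialDerivMatrix i B p := by
  ext l m
  exact partialDeriv_congr hU hp (fun q hq => by rw [hAB q hq]) i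

theorem partialDerivMatrix_transpose (i : Fin n) :
    partialDerivMatrix i (fun q => (A q).transpose) p = (partialDerivMatrix i A p).transpose := rfl

theorem partialDerivMatrix_comm (hU : IsOpen U) (hp : p ∈ U) (hA : SmoothMatrixOn A U)
    (i j : Fin n) : partialDerivMatrix i (partialDerivMatrix j A) p
      = partialDerivMatrix j (partialDerivMatrix i A) p := by
  ext l m
  exact partialDeriv_comm hU hp (hA l m) i j

end MatrixCalculus
end CoordGeometry
-- Levi-Civita connection, curvature and the Bianchi identities.
namespace CoordGeometry
variable {n : ℕ}

/-- `g` is a smooth pseudo-Riemannian metric on the open set `U`. -/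
structure IsMetricOn (g : (Fin n → ℝ) → Matrix (Fin n) (Fin n) ℝ) (U : Set (Fin n → ℝ)) :
    Prop where
  isOpen : IsOpen U
  smooth : SmoothMatrixOn g U
  symm : ∀ q ∈ U, ∀ i j, g q i j = g q j i
  det_ne_zero : ∀ q ∈ U, (g q).det ≠ 0

/-- The matrix `(Γᵢ)ₗᵐ = Γᵢₗᵐ` of connection coefficients. -/
noncomputable def christoffelMatrix (g : (Fin n → ℝ) → Matrix (Fin n) (Fin n) ℝ) (i : Fin n)
    (p : Fin n → ℝ) : Matrix (Fin n) (Fin n) ℝ := fun l m => christoffel g i l m p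

/-- The matrix `(Rⱼₖ)ₗᵐ = Rⱼₖₗᵐ` of curvature coefficients. -/
noncomputable def riemannMatrix (g : (Fin n → ℝ) → Matrix (Fin n) (Fin n) ℝ) (j k : Fin n)
    (p : Fin n → ℝ) : Matrix (Fin n) (Fin n) ℝ := fun l m => riemannUp g j k l m p

namespace IsMetricOn

variable {g : (Fin n → ℝ) → Matrix (Fin n) (Fin n) ℝ} {U : Set (Fin n → ℝ)} {p : Fin n → ℝ}

theorem transpose_eq (hg : IsMetricOn g U) (hp : p ∈ U) : (g p).transpose = g p := by
  ext i j; exact hg.symm p hp j i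

theorem mul_inv (hg : IsMetricOn g U) (hp : p ∈ U) : g p * (g p)⁻¹ = 1 :=
  Matrix.mul_nonsing_inv _ (hg.det_ne_zero p hp).isUnit

theorem inv_mul (hg : IsMetricOn g U) (hp : p ∈ U) : (g p)⁻¹ * g p = 1 :=
  Matrix.nonsing_inv_mul _ (hg.det_ne_zero p hp).isUnit

theorem inv_symm (hg : IsMetricOn g U) (hp : p ∈ U) (i j : Fin n) :
    (g p)⁻¹ i j = (g p)⁻¹ j i := by
  have h := Matrix.transpose_nonsing_inv (g p)
  rw [hg.transpose_eq hp] at h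
  exact congrFun (congrFun h j) i

theorem sum_mul_inv (hg : IsMetricOn g U) (hp : p ∈ U) (i j : Fin n) :
    ∑ r, g p i r * (g p)⁻¹ r j = if i = j then 1 else 0 := by
  have := congrFun (congrFun (hg.mul_inv hp) i) j
  rwa [Matrix.mul_apply, Matrix.one_apply] at this

theorem lower_raise (hg : IsMetricOn g U) (hp : p ∈ U) (v : Fin n → ℝ) (m : Fin n) :
    ∑ r, g p m r * ∑ s, (g p)⁻¹ r s * v s = v m := by
  have : (g p).mulVec ((g p)⁻¹.mulVec v) = v := by
    rw [Matrix.mulVec_mulVec, hg.mul_inv hp, Matrix.one_mulVec]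
  exact congrFun this m

theorem raise_lower (hg : IsMetricOn g U) (hp : p ∈ U) (v : Fin n → ℝ) (m : Fin n) :
    ∑ r, (g p)⁻¹ m r * ∑ s, g p r s * v s = v m := by
  have : (g p)⁻¹.mulVec ((g p).mulVec v) = v := by
    rw [Matrix.mulVec_mulVec, hg.inv_mul hp, Matrix.one_mulVec]
  exact congrFun this m

theorem smooth_inv (hg : IsMetricOn g U) : SmoothMatrixOn (fun q => (g q)⁻¹) U :=
  hg.smooth.inv hg.det_ne_zero

theorem smooth_christoffel (hg : IsMetricOn g U) (i j k : Fin n) :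
    ContDiffOn ℝ ∞ (christoffel g i j k) U := by
  have hd (a b c : Fin n) := contDiffOn_partialDeriv hg.isOpen (hg.smooth b c) a
  exact contDiffOn_const.mul (ContDiffOn.sum fun l _ =>
    (hg.smooth_inv k l).mul (((hd _ _ _).add (hd _ _ _)).sub (hd _ _ _)))

theorem smooth_riemannUp (hg : IsMetricOn g U) (j k l m : Fin n) :
    ContDiffOn ℝ ∞ (riemannUp g j k l m) U := by
  have hs := hg.smooth_christoffel
  have hd (a i j k : Fin n) := contDiffOn_partialDeriv hg.isOpen (hs i j k) a
  exact ((hd _ _ _ _).neg.add (hd _ _ _ _)).add (ContDiffOn.sum fun r _ =>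
    ((hs _ _ _).mul (hs _ _ _)).sub ((hs _ _ _).mul (hs _ _ _)))

theorem smooth_riemann (hg : IsMetricOn g U) (j k l m : Fin n) :
    ContDiffOn ℝ ∞ (riemann g j k l m) U :=
  ContDiffOn.sum fun r _ => (hg.smooth m r).mul (hg.smooth_riemannUp j k l r)

theorem smooth_ricci (hg : IsMetricOn g U) (k l : Fin n) : ContDiffOn ℝ ∞ (ricci g k l) U :=
  ContDiffOn.sum fun m _ => hg.smooth_riemannUp k m l m

theorem smooth_scalarCurvature (hg : IsMetricOn g U) : ContDiffOn ℝ ∞ (scalarCurvature g) U :=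
  ContDiffOn.sum fun k _ => ContDiffOn.sum fun l _ => (hg.smooth_inv k l).mul (hg.smooth_ricci k l)

theorem smooth_weyl (hg : IsMetricOn g U) (j k l m : Fin n) :
    ContDiffOn ℝ ∞ (weyl g j k l m) U := by
  have h1 := hg.smooth
  have h2 := hg.smooth_ricci
  refine ((hg.smooth_riemann j k l m).add (ContDiffOn.div_const ?_ _)).sub
    (ContDiffOn.div_const ?_ _)
  · exact ((((h1 _ _).mul (h2 _ _)).sub ((h1 _ _).mul (h2 _ _))).add
      ((h2 _ _).mul (h1 _ _))).sub ((h2 _ _).mul (h1 _ _))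
  · exact hg.smooth_scalarCurvature.mul
      (((h1 _ _).mul (h1 _ _)).sub ((h1 _ _).mul (h1 _ _)))

theorem smooth_weylUp (hg : IsMetricOn g U) (j k l m : Fin n) :
    ContDiffOn ℝ ∞ (weylUp g j k l m) U :=
  ContDiffOn.sum fun r _ => (hg.smooth_inv m r).mul (hg.smooth_weyl j k l r)

theorem smooth_christoffelMatrix (hg : IsMetricOn g U) (i : Fin n) :
    SmoothMatrixOn (christoffelMatrix g i) U := fun l m => hg.smooth_christoffel i l m

theorem partialDeriv_metric_symm (hg : IsMetricOn g U) (hp : p ∈ U) (i j k : Fin n) :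
    partialDeriv i (fun q => g q j k) p = partialDeriv i (fun q => g q k j) p :=
  partialDeriv_congr hg.isOpen hp (fun q hq => hg.symm q hq j k) i

theorem christoffel_symm (hg : IsMetricOn g U) (hp : p ∈ U) (i j k : Fin n) :
    christoffel g i j k p = christoffel g j i k p := by
  simp only [christoffel]
  congr 1
  refine Finset.sum_congr rfl fun l _ => ?_
  rw [hg.partialDeriv_metric_symm hp l i j]; ring

theorem lower_christoffel (hg : IsMetricOn g U) (hp : p ∈ U) (i j l : Fin n) :
    ∑ r, christoffel g i j r p * g p r l = (1 / 2) * (partialDeriv i (fun q => g q j l) p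
      + partialDeriv j (fun q => g q i l) p - partialDeriv l (fun q => g q i j) p) := by
  have := hg.lower_raise hp (fun l => (1 / 2) * (partialDeriv i (fun q => g q j l) p
      + partialDeriv j (fun q => g q i l) p - partialDeriv l (fun q => g q i j) p)) l
  rw [← this]
  refine Finset.sum_congr rfl fun r _ => ?_
  rw [christoffel, hg.symm p hp r l, mul_comm, Finset.mul_sum]
  congr 1
  exact Finset.sum_congr rfl fun s _ => by ring

/-- The Levi-Civita connection is metric. -/
theorem partialDeriv_metric (hg : IsMetricOn g U) (hp : p ∈ U) (i j k : Fin n) :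
    partialDeriv i (fun q => g q j k) p
      = ∑ r, (christoffel g i j r p * g p r k + christoffel g i k r p * g p j r) := by
  have h1 := hg.lower_christoffel hp i j k
  have h2 := hg.lower_christoffel hp i k j
  have h3 : ∑ r, christoffel g i k r p * g p j r = ∑ r, christoffel g i k r p * g p r j :=
    Finset.sum_congr rfl fun r _ => by rw [hg.symm p hp j r]
  rw [Finset.sum_add_distrib, h3, h1, h2, hg.partialDeriv_metric_symm hp i k j,
    hg.partialDeriv_metric_symm hp j i k, hg.partialDeriv_metric_symm hp k i j]
  ring

theorem partialDerivMatrix_metric (hg : IsMetricOn g U) (hp : p ∈ U) (i : Fin n) :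
    partialDerivMatrix i g p
      = christoffelMatrix g i p * g p + g p * (christoffelMatrix g i p).transpose := by
  ext j k
  simp only [partialDerivMatrix, Matrix.add_apply, Matrix.mul_apply, Matrix.transpose_apply,
    christoffelMatrix]
  rw [hg.partialDeriv_metric hp, Finset.sum_add_distrib]
  congr 1
  exact Finset.sum_congr rfl fun r _ => mul_comm _ _

/-- Differentiate `g g⁻¹ = 1`, insert the metricity of the connection and multiply by `g⁻¹` on the
left. -/
theorem partialDerivMatrix_inv (hg : IsMetricOn g U) (hp : p ∈ U) (i : Fin n) :
    partialDerivMatrix i (fun q => (g q)⁻¹) p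
      = - ((g p)⁻¹ * christoffelMatrix g i p + (christoffelMatrix g i p).transpose * (g p)⁻¹) := by
  have h : partialDerivMatrix i (fun q => g q * (g q)⁻¹) p = 0 := by
    rw [partialDerivMatrix_congr hg.isOpen hp (fun q hq => hg.mul_inv hq)]
    ext l m
    exact partialDeriv_const i _
  rw [partialDerivMatrix_mul hg.isOpen hp hg.smooth hg.smooth_inv,
    hg.partialDerivMatrix_metric hp] at h
  have h' := congrArg ((g p)⁻¹ * ·) h
  simp only [mul_zero, mul_add, add_mul, ← mul_assoc, hg.inv_mul hp, one_mul] at h'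
  rw [mul_assoc _ (g p), hg.mul_inv hp, mul_one] at h'
  rw [eq_neg_iff_add_eq_zero, ← h']
  abel

theorem partialDeriv_inv (hg : IsMetricOn g U) (hp : p ∈ U) (i j k : Fin n) :
    partialDeriv i (fun q => (g q)⁻¹ j k) p
      = - ∑ r, ((g p)⁻¹ j r * christoffel g i r k p + christoffel g i r j p * (g p)⁻¹ r k) := by
  have := congrFun (congrFun (hg.partialDerivMatrix_inv hp i) j) k
  simp only [partialDerivMatrix, Matrix.neg_apply, Matrix.add_apply, Matrix.mul_apply,
    Matrix.transpose_apply, christoffelMatrix] at this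
  rw [this, Finset.sum_add_distrib]

/-- Curvature as an exterior derivative plus a commutator of connection matrices. In this form the
antisymmetry and the second Bianchi identity become noncommutative algebra plus commuting partial
derivatives. -/
theorem riemannMatrix_eq (g : (Fin n → ℝ) → Matrix (Fin n) (Fin n) ℝ) (j k : Fin n)
    (p : Fin n → ℝ) : riemannMatrix g j k p
      = partialDerivMatrix k (christoffelMatrix g j) p
        - partialDerivMatrix j (christoffelMatrix g k) p
        + (christoffelMatrix g j p * christoffelMatrix g k p
          - christoffelMatrix g k p * christoffelMatrix g j p) := by
  ext l m
  simp only [riemannMatrix, riemannUp, Matrix.add_apply, Matrix.sub_apply, Matrix.mul_apply,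
    partialDerivMatrix, christoffelMatrix, Finset.sum_sub_distrib]
  rw [neg_add_eq_sub]

theorem riemannUp_antisymm (g : (Fin n → ℝ) → Matrix (Fin n) (Fin n) ℝ) (j k l m : Fin n)
    (p : Fin n → ℝ) : riemannUp g j k l m p = - riemannUp g k j l m p := by
  simp only [riemannUp, Finset.sum_sub_distrib]; ring

/-- Absence of torsion: with `Γ` symmetric in its lower indices, both the derivative and the
quadratic terms cancel in the cyclic sum. -/
theorem riemannUp_bianchi (hg : IsMetricOn g U) (hp : p ∈ U) (j k l m : Fin n) :
    riemannUp g j k l m p + riemannUp g k l j m p + riemannUp g l j k m p = 0 := by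
  have hc (a b : Fin n) (r : Fin n) := hg.christoffel_symm hp a b r
  have hd (i a b : Fin n) : partialDeriv i (christoffel g a b m) p
      = partialDeriv i (christoffel g b a m) p :=
    partialDeriv_congr hg.isOpen hp (fun q hq => hg.christoffel_symm hq a b m) i
  simp only [riemannUp, Finset.sum_sub_distrib]
  rw [hd j l k, hd k l j, hd j k l, hd l k j, hd k j l, hd l j k]
  simp only [hc l k, hc l j, hc k j]
  rw [hd j l k, hd k l j, hd l k j]
  ring

/-- The curvature is antisymmetric in the last two indices. -/
theorem riemannMatrix_mul_antisymm (hg : IsMetricOn g U) (hp : p ∈ U) (j k : Fin n) :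
    riemannMatrix g j k p * g p + g p * (riemannMatrix g j k p).transpose = 0 := by
  have hG := hg.smooth_christoffelMatrix
  have second (a b : Fin n) : partialDerivMatrix a (partialDerivMatrix b g) p
      = (partialDerivMatrix a (christoffelMatrix g b) p * g p
        + christoffelMatrix g b p * partialDerivMatrix a g p)
        + (partialDerivMatrix a g p * (christoffelMatrix g b p).transpose
        + g p * (partialDerivMatrix a (christoffelMatrix g b) p).transpose) := by
    rw [partialDerivMatrix_congr hg.isOpen hp (fun q hq => hg.partialDerivMatrix_metric hq b),
      partialDerivMatrix_add hg.isOpen hp ((hG b).mul hg.smooth)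
        (hg.smooth.mul (hG b).transpose),
      partialDerivMatrix_mul hg.isOpen hp (hG b) hg.smooth,
      partialDerivMatrix_mul hg.isOpen hp hg.smooth (hG b).transpose,
      partialDerivMatrix_transpose]
  -- Applied to `g`, the commuting second derivatives are the integrability condition of `∂g = Γg +
  -- gΓᵀ`, and that condition is the claim.
  have h := partialDerivMatrix_comm hg.isOpen hp hg.smooth j k
  rw [second, second, hg.partialDerivMatrix_metric hp, hg.partialDerivMatrix_metric hp] at h
  rw [← sub_eq_zero] at h
  rw [riemannMatrix_eq, ← neg_eq_zero, ← h]
  simp only [Matrix.transpose_add, Matrix.transpose_sub, Matrix.transpose_mul]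
  noncomm_ring

theorem riemann_antisymm_right (hg : IsMetricOn g U) (hp : p ∈ U) (j k l m : Fin n) :
    riemann g j k l m p = - riemann g j k m l p := by
  have h := congrFun (congrFun (hg.riemannMatrix_mul_antisymm hp j k) l) m
  simp only [Matrix.add_apply, Matrix.mul_apply, Matrix.transpose_apply, riemannMatrix,
    Matrix.zero_apply] at h
  rw [eq_neg_iff_add_eq_zero, ← h, riemann, riemann]
  congr 1
  exact Finset.sum_congr rfl fun r _ => by rw [hg.symm p hp m r, mul_comm]

/-- The second Bianchi identity, in matrix form. -/
theorem riemannMatrix_second_bianchi (hg : IsMetricOn g U) (hp : p ∈ U) (i j k : Fin n) :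
    (partialDerivMatrix i (riemannMatrix g j k) p + riemannMatrix g j k p * christoffelMatrix g i p
        - christoffelMatrix g i p * riemannMatrix g j k p)
      + (partialDerivMatrix j (riemannMatrix g k i) p
        + riemannMatrix g k i p * christoffelMatrix g j p
        - christoffelMatrix g j p * riemannMatrix g k i p)
      + (partialDerivMatrix k (riemannMatrix g i j) p
        + riemannMatrix g i j p * christoffelMatrix g k p
        - christoffelMatrix g k p * riemannMatrix g i j p) = 0 := by
  have hG := hg.smooth_christoffelMatrix
  have hd (a b : Fin n) := (hG a).partialDerivMatrix hg.isOpen b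
  have deriv (a b c : Fin n) : partialDerivMatrix a (riemannMatrix g b c) p
      = partialDerivMatrix a (partialDerivMatrix c (christoffelMatrix g b)) p
        - partialDerivMatrix a (partialDerivMatrix b (christoffelMatrix g c)) p
        + ((partialDerivMatrix a (christoffelMatrix g b) p * christoffelMatrix g c p
          + christoffelMatrix g b p * partialDerivMatrix a (christoffelMatrix g c) p)
          - (partialDerivMatrix a (christoffelMatrix g c) p * christoffelMatrix g b p
          + christoffelMatrix g c p * partialDerivMatrix a (christoffelMatrix g b) p)) := by
    rw [partialDerivMatrix_congr hg.isOpen hp (fun q _ => riemannMatrix_eq g b c q),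
      partialDerivMatrix_add hg.isOpen hp ((hd b c).sub (hd c b))
        (((hG b).mul (hG c)).sub ((hG c).mul (hG b))),
      partialDerivMatrix_sub hg.isOpen hp (hd b c) (hd c b),
      partialDerivMatrix_sub hg.isOpen hp ((hG b).mul (hG c)) ((hG c).mul (hG b)),
      partialDerivMatrix_mul hg.isOpen hp (hG b) (hG c),
      partialDerivMatrix_mul hg.isOpen hp (hG c) (hG b)]
  rw [deriv, deriv, deriv, partialDerivMatrix_comm hg.isOpen hp (hG k) i j,
    partialDerivMatrix_comm hg.isOpen hp (hG j) i k,
    partialDerivMatrix_comm hg.isOpen hp (hG i) j k,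
    riemannMatrix_eq, riemannMatrix_eq, riemannMatrix_eq]
  noncomm_ring

/-- The matrix form differentiates covariantly only in `l` and `m`. The connection terms on the
cyclic indices cancel among themselves, by the symmetry of `Γ` and the antisymmetry of the
curvature. -/
theorem riemannUp_second_bianchi (hg : IsMetricOn g U) (hp : p ∈ U) (i j k l m : Fin n) :
    covDerivTensor g (riemannUp g) i j k l m p + covDerivTensor g (riemannUp g) j k i l m p
      + covDerivTensor g (riemannUp g) k i j l m p = 0 := by
  have h := congrFun (congrFun (hg.riemannMatrix_second_bianchi hp i j k) l) m
  simp only [Matrix.add_apply, Matrix.sub_apply, Matrix.mul_apply, partialDerivMatrix,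
    riemannMatrix, christoffelMatrix, Matrix.zero_apply] at h
  rw [← h]
  have hc (a b : Fin n) (r : Fin n) := hg.christoffel_symm hp a b r
  have e1 (a b c : Fin n) : ∑ r, christoffel g a b r p * riemannUp g r c l m p
      = - ∑ r, christoffel g a b r p * riemannUp g c r l m p := by
    rw [← Finset.sum_neg_distrib]
    exact Finset.sum_congr rfl fun r _ => by rw [riemannUp_antisymm g r c]; ring
  have e2 (a b c : Fin n) : ∑ r, riemannUp g a b l r p * christoffel g c r m p
      = ∑ r, christoffel g c r m p * riemannUp g a b l r p :=
    Finset.sum_congr rfl fun r _ => mul_comm _ _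
  simp only [covDerivTensor, Finset.sum_sub_distrib, e1, e2]
  simp only [hc k j, hc k i, hc j i]
  ring

end IsMetricOn
end CoordGeometry
-- Schouten and Weyl tensors, and the second Bianchi identity for a harmonic Weyl tensor.
namespace CoordGeometry
variable {n : ℕ}

/-- The octahedron argument: a linear combination of the four cyclic identities, one for each choice
of the fixed last index, reduced by the two antisymmetries. -/
theorem pair_symm_of_bianchi {T : Fin n → Fin n → Fin n → Fin n → ℝ}
    (h1 : ∀ j k l m, T j k l m = - T k j l m) (h2 : ∀ j k l m, T j k l m = - T j k m l)
    (h3 : ∀ j k l m, T j k l m + T k l j m + T l j k m = 0) (j k l m : Fin n) :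
    T j k l m = T l m j k := by
  linarith [h3 j k l m, h3 k l m j, h3 l m j k, h3 m j k l, h1 j k l m, h1 k l j m, h1 l j k m,
    h1 k l m j, h1 l m k j, h1 m k l j, h1 l m j k, h1 m j l k, h1 j l m k, h1 m j k l,
    h1 j k m l, h1 k m j l, h2 j k l m, h2 k l j m, h2 l j k m, h2 k l m j, h2 l m k j, h2 m k l j,
    h2 l m j k, h2 m j l k, h2 j l m k, h2 m j k l, h2 j k m l, h2 k m j l]

/-- The Schouten tensor, all indices down. -/
noncomputable def schouten (g : (Fin n → ℝ) → Matrix (Fin n) (Fin n) ℝ) (p : Fin n → ℝ) :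
    Matrix (Fin n) (Fin n) ℝ := fun k l =>
  ricci g k l p / ((n : ℝ) - 2)
    - scalarCurvature g p * g p k l / (2 * (((n : ℝ) - 1) * ((n : ℝ) - 2)))

/-- The Schouten tensor `Pⱼᵐ`, with the second index raised. -/
noncomputable def schoutenUp (g : (Fin n → ℝ) → Matrix (Fin n) (Fin n) ℝ) (p : Fin n → ℝ) :
    Matrix (Fin n) (Fin n) ℝ := schouten g p * (g p)⁻¹

/-- The covariant derivative `∇ᵢ Pₖₗ` of a tensor with two lower indices. -/
noncomputable def covDerivLower (g P : (Fin n → ℝ) → Matrix (Fin n) (Fin n) ℝ) (i : Fin n)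
    (p : Fin n → ℝ) : Matrix (Fin n) (Fin n) ℝ :=
  partialDerivMatrix i P p - christoffelMatrix g i p * P p
    - P p * (christoffelMatrix g i p).transpose

/-- The covariant derivative `∇ᵢ Qⱼᵐ` of a tensor with one lower and one upper index. -/
noncomputable def covDerivMixed (g Q : (Fin n → ℝ) → Matrix (Fin n) (Fin n) ℝ) (i : Fin n)
    (p : Fin n → ℝ) : Matrix (Fin n) (Fin n) ℝ :=
  partialDerivMatrix i Q p + Q p * christoffelMatrix g i p - christoffelMatrix g i p * Q p

section CovariantDerivative

variable {g P Q : (Fin n → ℝ) → Matrix (Fin n) (Fin n) ℝ} {U : Set (Fin n → ℝ)} {p : Fin n → ℝ}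
  {T S : Fin n → Fin n → Fin n → Fin n → (Fin n → ℝ) → ℝ}

theorem covDerivTensor_add (hT : ∀ j k l m, DifferentiableAt ℝ (T j k l m) p)
    (hS : ∀ j k l m, DifferentiableAt ℝ (S j k l m) p) (i j k l m : Fin n) :
    covDerivTensor g (fun j k l m q => T j k l m q + S j k l m q) i j k l m p
      = covDerivTensor g T i j k l m p + covDerivTensor g S i j k l m p := by
  simp only [covDerivTensor]
  rw [partialDeriv_add i (hT _ _ _ _) (hS _ _ _ _), add_add_add_comm, ← Finset.sum_add_distrib]
  congr 1
  exact Finset.sum_congr rfl fun r _ => by ring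

theorem covDerivTensor_sub (hT : ∀ j k l m, DifferentiableAt ℝ (T j k l m) p)
    (hS : ∀ j k l m, DifferentiableAt ℝ (S j k l m) p) (i j k l m : Fin n) :
    covDerivTensor g (fun j k l m q => T j k l m q - S j k l m q) i j k l m p
      = covDerivTensor g T i j k l m p - covDerivTensor g S i j k l m p := by
  simp only [covDerivTensor]
  rw [partialDeriv_sub i (hT _ _ _ _) (hS _ _ _ _), add_sub_add_comm, ← Finset.sum_sub_distrib]
  congr 1
  exact Finset.sum_congr rfl fun r _ => by ring

theorem covDerivTensor_congr (hU : IsOpen U) (hp : p ∈ U)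
    (h : ∀ q ∈ U, ∀ j k l m, T j k l m q = S j k l m q) (i j k l m : Fin n) :
    covDerivTensor g T i j k l m p = covDerivTensor g S i j k l m p := by
  simp only [covDerivTensor, h p hp]
  rw [partialDeriv_congr hU hp (fun q hq => h q hq j k l m)]

/-- Leibniz rule for the building blocks of the Weyl correction, with the indices paired as `(j, m)`
and `(k, l)`. The other pairing comes from `covDerivTensor_swap`. -/
theorem covDerivTensor_mul (hQ : ∀ j m, DifferentiableAt ℝ (fun q => Q q j m) p)
    (hP : ∀ k l, DifferentiableAt ℝ (fun q => P q k l) p) (i j k l m : Fin n) :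
    covDerivTensor g (fun j k l m q => Q q j m * P q k l) i j k l m p
      = covDerivMixed g Q i p j m * P p k l + Q p j m * covDerivLower g P i p k l := by
  simp only [covDerivTensor, covDerivMixed, covDerivLower, Matrix.add_apply, Matrix.sub_apply,
    Matrix.mul_apply, Matrix.transpose_apply, partialDerivMatrix, christoffelMatrix]
  rw [partialDeriv_mul i (hQ j m) (hP k l)]
  simp only [Finset.sum_sub_distrib, add_mul, sub_mul, mul_sub, Finset.sum_mul, Finset.mul_sum]
  have e1 : ∑ r, Q p j r * christoffel g i r m p * P p k l
      = ∑ r, christoffel g i r m p * (Q p j r * P p k l) :=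
    Finset.sum_congr rfl fun r _ => by ring
  have e2 : ∑ r, christoffel g i j r p * Q p r m * P p k l
      = ∑ r, christoffel g i j r p * (Q p r m * P p k l) :=
    Finset.sum_congr rfl fun r _ => by ring
  have e3 : ∑ r, Q p j m * (christoffel g i k r p * P p r l)
      = ∑ r, christoffel g i k r p * (Q p j m * P p r l) :=
    Finset.sum_congr rfl fun r _ => by ring
  have e4 : ∑ r, Q p j m * (P p k r * christoffel g i l r p)
      = ∑ r, christoffel g i l r p * (Q p j m * P p k r) :=
    Finset.sum_congr rfl fun r _ => by ring
  rw [e1, e2, e3, e4]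
  ring

theorem covDerivTensor_swap (i j k l m : Fin n) :
    covDerivTensor g (fun j k l m => T k j l m) i j k l m p
      = covDerivTensor g T i k j l m p := by
  simp only [covDerivTensor, Finset.sum_sub_distrib]
  ring

/-- Contraction of the first and the last index commutes with covariant derivatives. -/
theorem sum_covDerivTensor_trace (hT : ∀ j k l m, DifferentiableAt ℝ (T j k l m) p)
    (i k l : Fin n) :
    ∑ m, covDerivTensor g T i m k l m p
      = partialDeriv i (fun q => ∑ m, T m k l m q) p
        - ∑ r, (christoffel g i k r p * ∑ m, T m r l m p
          + christoffel g i l r p * ∑ m, T m k r m p) := by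
  rw [partialDeriv_sum _ _ (fun m _ => hT m k l m)]
  simp only [covDerivTensor, Finset.sum_add_distrib, Finset.sum_sub_distrib, Finset.mul_sum]
  rw [Finset.sum_comm (f := fun m r => christoffel g i m r p * T r k l m p),
    Finset.sum_comm (f := fun m r => christoffel g i k r p * T m r l m p),
    Finset.sum_comm (f := fun m r => christoffel g i l r p * T m k r m p)]
  ring

theorem covDerivMixed_one (i : Fin n) : covDerivMixed g (fun _ => 1) i p = 0 := by
  have : partialDerivMatrix i (fun _ : Fin n → ℝ => (1 : Matrix (Fin n) (Fin n) ℝ)) p = 0 := by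
    ext l m; exact partialDeriv_const i _
  simp [covDerivMixed, this]

theorem IsMetricOn.covDerivLower_metric (hg : IsMetricOn g U) (hp : p ∈ U) (i : Fin n) :
    covDerivLower g g i p = 0 := by
  rw [covDerivLower, hg.partialDerivMatrix_metric hp]; abel

/-- Since `∇g = 0`, lowering an index commutes with covariant differentiation. -/
theorem IsMetricOn.covDerivLower_mul (hg : IsMetricOn g U) (hp : p ∈ U) (hQ : SmoothMatrixOn Q U)
    (hPQ : ∀ q ∈ U, P q = Q q * g q) (i : Fin n) :
    covDerivLower g P i p = covDerivMixed g Q i p * g p := by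
  rw [covDerivLower, covDerivMixed, partialDerivMatrix_congr hg.isOpen hp hPQ,
    partialDerivMatrix_mul hg.isOpen hp hQ hg.smooth, hg.partialDerivMatrix_metric hp, hPQ p hp]
  noncomm_ring

end CovariantDerivative

/-- The algebra of the contracted Bianchi identity for the Weyl tensor: a Cotton tensor whose
Bianchi expression is trace-free vanishes. -/
theorem cotton_eq_zero_of_contraction (hn : 4 ≤ n) {G Gi : Matrix (Fin n) (Fin n) ℝ}
    (hG : ∀ j m, ∑ l, G j l * Gi l m = if j = m then 1 else 0)
    {A B : Fin n → Fin n → Fin n → ℝ}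
    (hA : ∀ j k l, A j k l = - A k j l) (hB : ∀ j k m, B j k m = - B k j m)
    (hAB : ∀ j k l, A j k l = ∑ m, B j k m * G m l)
    (hBA : ∀ j k m, B j k m = ∑ l, A j k l * Gi l m)
    (h : ∀ j k l, ∑ m, (-((if m = m then (1 : ℝ) else 0) * A j k l
        + (if j = m then 1 else 0) * A k m l + (if k = m then 1 else 0) * A m j l)
        + (G m l * B j k m + G j l * B k m m + G k l * B m j m)) = 0) (j k l : Fin n) :
    A j k l = 0 ∧ B j k l = 0 := by
  have hn3 : (4 : ℝ) ≤ n := by exact_mod_cast hn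
  -- The factor `n - 3` collects `n` from the trace of the Kronecker delta, `-1` from each of the
  -- two other deltas, and `-1` from lowering `B` to `A`.
  have e1 (j k l : Fin n) : ((n : ℝ) - 3) * A j k l
      = G j l * (∑ m, B k m m) - G k l * ∑ m, B j m m := by
    have := h j k l
    simp only [if_true, one_mul, Finset.sum_add_distrib, Finset.sum_neg_distrib, Finset.sum_const,
      Finset.card_univ, Fintype.card_fin, nsmul_eq_mul, ite_mul, zero_mul, Finset.sum_ite_eq,
      Finset.mem_univ, ← Finset.mul_sum] at this
    have h1 : ∑ m, G m l * B j k m = A j k l := by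
      rw [hAB]; exact Finset.sum_congr rfl fun m _ => mul_comm _ _
    have h2 : ∑ m, B m j m = - ∑ m, B j m m := by
      rw [← Finset.sum_neg_distrib]; exact Finset.sum_congr rfl fun m _ => hB _ _ _
    rw [h1, h2, hA k j l] at this
    linarith
  have e2 (j k m : Fin n) : ((n : ℝ) - 3) * B j k m
      = (if j = m then 1 else 0) * (∑ r, B k r r) - (if k = m then 1 else 0) * ∑ r, B j r r := by
    rw [hBA, Finset.mul_sum, ← hG j m, ← hG k m, Finset.sum_mul, Finset.sum_mul,
      ← Finset.sum_sub_distrib]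
    exact Finset.sum_congr rfl fun l _ => by rw [← mul_assoc, e1]; ring
  -- Tracing `e2` gives `(n - 3) tr = (1 - n) tr`, that is `(2n - 4) tr = 0`.
  have e3 (j : Fin n) : ∑ r, B j r r = 0 := by
    have : ((n : ℝ) - 3) * ∑ r, B j r r = ∑ r, ((if j = r then 1 else 0) * (∑ s, B r s s)
        - (if r = r then 1 else 0) * ∑ s, B j s s) := by
      rw [Finset.mul_sum]; exact Finset.sum_congr rfl fun r _ => e2 j r r
    simp only [if_true, one_mul, Finset.sum_sub_distrib, ite_mul, zero_mul, Finset.sum_ite_eq,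
      Finset.mem_univ, Finset.sum_const, Finset.card_univ, Fintype.card_fin, nsmul_eq_mul] at this
    have h0 : (2 * (n : ℝ) - 4) * ∑ r, B j r r = 0 := by linarith
    exact (mul_eq_zero.1 h0).resolve_left (by linarith)
  have hne : (n : ℝ) - 3 ≠ 0 := by linarith
  have hB0 (j k m : Fin n) : B j k m = 0 := by
    have := e2 j k m
    rw [e3, e3, mul_zero, mul_zero, sub_zero] at this
    exact (mul_eq_zero.1 this).resolve_left hne
  exact ⟨by simp [hAB, hB0], hB0 _ _ _⟩

namespace IsMetricOn

variable {g : (Fin n → ℝ) → Matrix (Fin n) (Fin n) ℝ} {U : Set (Fin n → ℝ)} {p : Fin n → ℝ}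

theorem riemann_antisymm_left (g : (Fin n → ℝ) → Matrix (Fin n) (Fin n) ℝ) (j k l m : Fin n)
    (p : Fin n → ℝ) : riemann g j k l m p = - riemann g k j l m p := by
  simp only [riemann, ← Finset.sum_neg_distrib]
  exact Finset.sum_congr rfl fun r _ => by rw [riemannUp_antisymm g j k]; ring

theorem riemann_bianchi (hg : IsMetricOn g U) (hp : p ∈ U) (j k l m : Fin n) :
    riemann g j k l m p + riemann g k l j m p + riemann g l j k m p = 0 := by
  simp only [riemann, ← Finset.sum_add_distrib, ← mul_add, hg.riemannUp_bianchi hp, mul_zero,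
    Finset.sum_const_zero]

theorem riemannUp_eq_sum (hg : IsMetricOn g U) (hp : p ∈ U) (j k l m : Fin n) :
    riemannUp g j k l m p = ∑ r, (g p)⁻¹ m r * riemann g j k l r p :=
  (hg.raise_lower hp (fun m => riemannUp g j k l m p) m).symm

theorem ricci_eq_sum (hg : IsMetricOn g U) (hp : p ∈ U) (k l : Fin n) :
    ricci g k l p = ∑ m, ∑ r, (g p)⁻¹ m r * riemann g k m l r p := by
  simp only [ricci, hg.riemannUp_eq_sum hp]

theorem ricci_symm (hg : IsMetricOn g U) (hp : p ∈ U) (k l : Fin n) :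
    ricci g k l p = ricci g l k p := by
  rw [hg.ricci_eq_sum hp, hg.ricci_eq_sum hp, Finset.sum_comm]
  refine Finset.sum_congr rfl fun r _ => Finset.sum_congr rfl fun m _ => ?_
  rw [hg.inv_symm hp m r, pair_symm_of_bianchi (T := fun j k l m => riemann g j k l m p)
    (fun j k l m => riemann_antisymm_left g j k l m p) (hg.riemann_antisymm_right hp)
    (hg.riemann_bianchi hp) k m l r]

/-- The scalar-curvature term splits evenly between two Ricci terms, so the whole correction is the
Kulkarni–Nomizu product of `g` with the Schouten tensor. -/
theorem weyl_eq (hn : 4 ≤ n) (j k l m : Fin n) :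
    weyl g j k l m p = riemann g j k l m p + (g p j m * schouten g p k l
      - g p k m * schouten g p j l + schouten g p j m * g p k l - schouten g p k m * g p j l) := by
  have hn3 : (4 : ℝ) ≤ n := by exact_mod_cast hn
  have h1 : (n : ℝ) - 1 ≠ 0 := by linarith
  have h2 : (n : ℝ) - 2 ≠ 0 := by linarith
  simp only [weyl, schouten]
  field_simp
  ring

theorem weyl_antisymm_left (j k l m : Fin n) :
    weyl g j k l m p = - weyl g k j l m p := by
  simp only [weyl]; rw [riemann_antisymm_left g j k l m p]; ring

theorem weyl_antisymm_right (hg : IsMetricOn g U) (hp : p ∈ U) (j k l m : Fin n) :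
    weyl g j k l m p = - weyl g j k m l p := by
  simp only [weyl]; rw [hg.riemann_antisymm_right hp j k l m]; ring

theorem weyl_bianchi (hg : IsMetricOn g U) (hp : p ∈ U) (j k l m : Fin n) :
    weyl g j k l m p + weyl g k l j m p + weyl g l j k m p = 0 := by
  have h := hg.riemann_bianchi hp j k l m
  have hr := hg.ricci_symm hp
  have hs := hg.symm p hp
  simp only [weyl]
  rw [hr l k, hr l j, hr j k, hs l k, hs l j, hs j k]
  linear_combination h

theorem weyl_pair_symm (hg : IsMetricOn g U) (hp : p ∈ U) (j k l m : Fin n) :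
    weyl g j k l m p = weyl g l m j k p :=
  pair_symm_of_bianchi (T := fun j k l m => weyl g j k l m p)
    weyl_antisymm_left (hg.weyl_antisymm_right hp) (hg.weyl_bianchi hp) j k l m

theorem weyl_eq_sum (hg : IsMetricOn g U) (hp : p ∈ U) (j k l m : Fin n) :
    weyl g j k l m p = ∑ r, g p m r * weylUp g j k l r p :=
  (hg.lower_raise hp (fun m => weyl g j k l m p) m).symm

theorem weylUp_antisymm (j k l m : Fin n) : weylUp g j k l m p = - weylUp g k j l m p := by
  simp only [weylUp, ← Finset.sum_neg_distrib]
  exact Finset.sum_congr rfl fun r _ => by rw [weyl_antisymm_left j k]; ring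

theorem schouten_eq_mul (hg : IsMetricOn g U) (hp : p ∈ U) :
    schouten g p = schoutenUp g p * g p := by
  rw [schoutenUp, mul_assoc, hg.inv_mul hp, mul_one]

theorem weylUp_eq (hg : IsMetricOn g U) (hn : 4 ≤ n) (hp : p ∈ U) (j k l m : Fin n) :
    weylUp g j k l m p = riemannUp g j k l m p
      + ((1 : Matrix (Fin n) (Fin n) ℝ) j m * schouten g p k l
      - (1 : Matrix (Fin n) (Fin n) ℝ) k m * schouten g p j l
      + schoutenUp g p j m * g p k l - schoutenUp g p k m * g p j l) := by
  have hd (a : Fin n) : ∑ r, (g p)⁻¹ m r * g p a r = (1 : Matrix (Fin n) (Fin n) ℝ) a m := by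
    rw [Matrix.one_apply, ← hg.sum_mul_inv hp a m]
    exact Finset.sum_congr rfl fun r _ => by rw [hg.inv_symm hp m r, mul_comm]
  have hP (a : Fin n) : ∑ r, (g p)⁻¹ m r * schouten g p a r = schoutenUp g p a m := by
    rw [schoutenUp, Matrix.mul_apply]
    exact Finset.sum_congr rfl fun r _ => by rw [hg.inv_symm hp m r, mul_comm]
  rw [hg.riemannUp_eq_sum hp, ← hd j, ← hd k, ← hP j, ← hP k]
  simp only [weylUp, Finset.sum_mul, ← Finset.sum_add_distrib, ← Finset.sum_sub_distrib]
  exact Finset.sum_congr rfl fun r _ => by rw [weyl_eq hn]; ring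

theorem sum_schoutenUp (hg : IsMetricOn g U) (hn : 4 ≤ n) (hp : p ∈ U) :
    ∑ m, schoutenUp g p m m = scalarCurvature g p / (2 * ((n : ℝ) - 1)) := by
  have hn3 : (4 : ℝ) ≤ n := by exact_mod_cast hn
  have h1 : (n : ℝ) - 1 ≠ 0 := by linarith
  have h2 : (n : ℝ) - 2 ≠ 0 := by linarith
  have e1 : ∑ m, ∑ r, ricci g m r p * (g p)⁻¹ r m = scalarCurvature g p :=
    Finset.sum_congr rfl fun m _ => Finset.sum_congr rfl fun r _ => by
      rw [hg.inv_symm hp, mul_comm]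
  have e2 : ∑ m, ∑ r, g p m r * (g p)⁻¹ r m = n := by simp [hg.sum_mul_inv hp]
  have : ∑ m, schoutenUp g p m m
      = (∑ m, ∑ r, ricci g m r p * (g p)⁻¹ r m) / ((n : ℝ) - 2)
        - scalarCurvature g p * (∑ m, ∑ r, g p m r * (g p)⁻¹ r m)
          / (2 * (((n : ℝ) - 1) * ((n : ℝ) - 2))) := by
    simp only [schoutenUp, Matrix.mul_apply, schouten, sub_mul, Finset.sum_sub_distrib,
      Finset.sum_div, Finset.mul_sum]
    congr 1 <;>
    exact Finset.sum_congr rfl fun m _ => Finset.sum_congr rfl fun r _ => by ring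
  rw [this, e1, e2]
  field_simp
  ring

/-- The Weyl tensor is trace-free. -/
theorem sum_weylUp (hg : IsMetricOn g U) (hn : 4 ≤ n) (hp : p ∈ U) (k l : Fin n) :
    ∑ m, weylUp g m k l m p = 0 := by
  have hn3 : (4 : ℝ) ≤ n := by exact_mod_cast hn
  have h1 : (n : ℝ) - 1 ≠ 0 := by linarith
  have h2 : (n : ℝ) - 2 ≠ 0 := by linarith
  have e1 : ∑ m, riemannUp g m k l m p = - ricci g k l p := by
    simp only [ricci, ← Finset.sum_neg_distrib]
    exact Finset.sum_congr rfl fun m _ => riemannUp_antisymm g m k l m p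
  have e2 : ∑ m, schoutenUp g p k m * g p m l = schouten g p k l := by
    rw [hg.schouten_eq_mul hp, Matrix.mul_apply]
  simp only [hg.weylUp_eq hn hp, Finset.sum_add_distrib, Finset.sum_sub_distrib, ← Finset.sum_mul,
    hg.sum_schoutenUp hn hp, e1, e2, Matrix.one_apply, if_true, ite_mul, one_mul, zero_mul,
    Finset.sum_ite_eq, Finset.mem_univ, Finset.sum_const, Finset.card_univ, Fintype.card_fin,
    nsmul_eq_mul]
  simp only [schouten]
  field_simp
  ring

theorem smooth_schouten (hg : IsMetricOn g U) : SmoothMatrixOn (schouten g) U := fun k l =>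
  ((hg.smooth_ricci k l).div_const _).sub
    ((hg.smooth_scalarCurvature.mul (hg.smooth k l)).div_const _)

theorem smooth_schoutenUp (hg : IsMetricOn g U) : SmoothMatrixOn (schoutenUp g) U :=
  hg.smooth_schouten.mul hg.smooth_inv

/-- Both the metric and the identity tensor are parallel, so the derivative falls only on the
curvature and the Schouten tensor. -/
theorem covDerivTensor_weylUp (hg : IsMetricOn g U) (hn : 4 ≤ n) (hp : p ∈ U)
    (i j k l m : Fin n) :
    covDerivTensor g (weylUp g) i j k l m p = covDerivTensor g (riemannUp g) i j k l m p
      + ((1 : Matrix (Fin n) (Fin n) ℝ) j m * covDerivLower g (schouten g) i p k l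
      - (1 : Matrix (Fin n) (Fin n) ℝ) k m * covDerivLower g (schouten g) i p j l
      + covDerivMixed g (schoutenUp g) i p j m * g p k l
      - covDerivMixed g (schoutenUp g) i p k m * g p j l) := by
  have hU := hg.isOpen
  have dR (j k l m : Fin n) := differentiableAt_of_contDiffOn hU hp (hg.smooth_riemannUp j k l m)
  have dP (k l : Fin n) := differentiableAt_of_contDiffOn hU hp (hg.smooth_schouten k l)
  have dQ (k l : Fin n) := differentiableAt_of_contDiffOn hU hp (hg.smooth_schoutenUp k l)
  have dg (k l : Fin n) := differentiableAt_of_contDiffOn hU hp (hg.smooth k l)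
  have d1 (k l : Fin n) : DifferentiableAt ℝ
    (fun _ : Fin n → ℝ => (1 : Matrix (Fin n) (Fin n) ℝ) k l) p := differentiableAt_const _
  rw [covDerivTensor_congr hU hp (fun q hq j k l m => hg.weylUp_eq hn hq j k l m),
    covDerivTensor_add dR (S := fun j k l m q => (1 : Matrix (Fin n) (Fin n) ℝ) j m
      * schouten g q k l - (1 : Matrix (Fin n) (Fin n) ℝ) k m * schouten g q j l
      + schoutenUp g q j m * g q k l - schoutenUp g q k m * g q j l)
      (fun j k l m => ((((d1 j m).mul (dP k l)).sub ((d1 k m).mul (dP j l))).add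
        ((dQ j m).mul (dg k l))).sub ((dQ k m).mul (dg j l))),
    covDerivTensor_sub (T := fun j k l m q => (1 : Matrix (Fin n) (Fin n) ℝ) j m
      * schouten g q k l - (1 : Matrix (Fin n) (Fin n) ℝ) k m * schouten g q j l
      + schoutenUp g q j m * g q k l)
      (S := fun j k l m q => schoutenUp g q k m * g q j l)
      (fun j k l m => (((d1 j m).mul (dP k l)).sub ((d1 k m).mul (dP j l))).add
        ((dQ j m).mul (dg k l))) (fun j k l m => (dQ k m).mul (dg j l)),
    covDerivTensor_add (T := fun j k l m q => (1 : Matrix (Fin n) (Fin n) ℝ) j m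
      * schouten g q k l - (1 : Matrix (Fin n) (Fin n) ℝ) k m * schouten g q j l)
      (S := fun j k l m q => schoutenUp g q j m * g q k l)
      (fun j k l m => ((d1 j m).mul (dP k l)).sub ((d1 k m).mul (dP j l)))
      (fun j k l m => (dQ j m).mul (dg k l)),
    covDerivTensor_sub (T := fun j k l m q => (1 : Matrix (Fin n) (Fin n) ℝ) j m
      * schouten g q k l) (S := fun j k l m q => (1 : Matrix (Fin n) (Fin n) ℝ) k m
        * schouten g q j l)
      (fun j k l m => (d1 j m).mul (dP k l)) (fun j k l m => (d1 k m).mul (dP j l)),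
    covDerivTensor_swap (T := fun j k l m q => schoutenUp g q j m * g q k l),
    covDerivTensor_swap (T := fun j k l m q => (1 : Matrix (Fin n) (Fin n) ℝ) j m
      * schouten g q k l),
    covDerivTensor_mul dQ dg, covDerivTensor_mul dQ dg,
    covDerivTensor_mul (Q := fun _ => 1) d1 dP, covDerivTensor_mul (Q := fun _ => 1) d1 dP,
    hg.covDerivLower_metric hp, covDerivMixed_one]
  simp

/-- If the Weyl tensor is divergence-free, it satisfies the second Bianchi identity. -/
theorem weylUp_second_bianchi (hg : IsMetricOn g U) (hn : 4 ≤ n) (hp : p ∈ U)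
    (hdiv : ∀ j k l, divWeyl g j k l p = 0) (i j k l m : Fin n) :
    covDerivTensor g (weylUp g) i j k l m p + covDerivTensor g (weylUp g) j k i l m p
      + covDerivTensor g (weylUp g) k i j l m p = 0 := by
  set A : Fin n → Fin n → Fin n → ℝ := fun j k l =>
    covDerivLower g (schouten g) j p k l - covDerivLower g (schouten g) k p j l with hA
  set B : Fin n → Fin n → Fin n → ℝ := fun j k m =>
    covDerivMixed g (schoutenUp g) j p k m - covDerivMixed g (schoutenUp g) k p j m with hB
  -- The curvature drops out by its own Bianchi identity. What remains is the Cotton tensor, in its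
  -- lowered form `A` and its raised form `B`.
  have cyc (i j k l m : Fin n) :
      covDerivTensor g (weylUp g) i j k l m p + covDerivTensor g (weylUp g) j k i l m p
        + covDerivTensor g (weylUp g) k i j l m p
      = -((if i = m then (1 : ℝ) else 0) * A j k l + (if j = m then 1 else 0) * A k i l
          + (if k = m then 1 else 0) * A i j l)
        + (g p i l * B j k m + g p j l * B k i m + g p k l * B i j m) := by
    simp only [hg.covDerivTensor_weylUp hn hp, Matrix.one_apply, hA, hB]
    linear_combination hg.riemannUp_second_bianchi hp i j k l m
  have hlow (i : Fin n) : covDerivLower g (schouten g) i p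
      = covDerivMixed g (schoutenUp g) i p * g p :=
    hg.covDerivLower_mul hp hg.smooth_schoutenUp (fun q hq => hg.schouten_eq_mul hq) i
  have hup (i : Fin n) : covDerivMixed g (schoutenUp g) i p
      = covDerivLower g (schouten g) i p * (g p)⁻¹ := by
    rw [hlow, mul_assoc, hg.mul_inv hp, mul_one]
  have dC (j k l m : Fin n) := differentiableAt_of_contDiffOn hg.isOpen hp
    (hg.smooth_weylUp j k l m)
  have htr (i k l : Fin n) : ∑ m, covDerivTensor g (weylUp g) i m k l m p = 0 := by
    rw [sum_covDerivTensor_trace dC,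
      partialDeriv_eq_zero hg.isOpen hp (fun q hq => hg.sum_weylUp hn hq k l)]
    simp [hg.sum_weylUp hn hp]
  have hanti (i j k l m : Fin n) : covDerivTensor g (weylUp g) i j k l m p
      = - covDerivTensor g (weylUp g) i k j l m p := by
    have h := covDerivTensor_add (g := g) dC (fun j k l m => dC k j l m) i j k l m
    rw [covDerivTensor_congr (S := fun _ _ _ _ _ => 0) hg.isOpen hp
        (fun q _ j k l m => by rw [weylUp_antisymm k j]; ring)] at h
    rw [eq_neg_iff_add_eq_zero, ← covDerivTensor_swap (T := weylUp g) i j k, ← h]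
    simp [covDerivTensor, partialDeriv_const]
  -- Contracting `i` with `m`, one term of the cyclic sum is the divergence and the other two are
  -- derivatives of traces, so all vanish.
  have zero := cotton_eq_zero_of_contraction hn (hg.sum_mul_inv hp) (A := A) (B := B)
    (fun j k l => by simp only [hA]; ring) (fun j k l => by simp only [hB]; ring)
    (fun j k l => by
      simp only [hA, hB, hlow, Matrix.mul_apply, ← Finset.sum_sub_distrib, sub_mul])
    (fun j k l => by
      simp only [hA, hB, hup, Matrix.mul_apply, ← Finset.sum_sub_distrib, sub_mul])
    (fun j k l => by
      rw [← Finset.sum_congr rfl fun m _ => cyc m j k l m, Finset.sum_add_distrib,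
        Finset.sum_add_distrib]
      have h1 : ∑ m, covDerivTensor g (weylUp g) j k m l m p = 0 := by
        rw [← neg_eq_zero, ← Finset.sum_neg_distrib, ← htr j k l]
        exact Finset.sum_congr rfl fun m _ => by rw [hanti j k m, neg_neg]
      rw [h1, htr k j l, ← divWeyl, hdiv]; simp)
  rw [cyc]
  simp [zero]

end IsMetricOn
end CoordGeometry
-- Curvature of warped metrics in coordinates, and the electric part.
namespace CoordGeometry
variable {d : ℕ}

/-- On `U` the metric is block-diagonal, its time-time component does not depend on time, and its
space components are rescaled in time at the rate `2 H`, where `H` depends only on time. -/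
structure IsWarpedOn (g : (Fin (d + 1) → ℝ) → Matrix (Fin (d + 1)) (Fin (d + 1)) ℝ)
    (H : (Fin (d + 1) → ℝ) → ℝ) (U : Set (Fin (d + 1) → ℝ)) : Prop extends IsMetricOn g U where
  mixed : ∀ q ∈ U, ∀ μ : Fin d, g q 0 μ.succ = 0
  deriv_time : ∀ q ∈ U, partialDeriv 0 (fun q => g q 0 0) q = 0
  deriv_space : ∀ q ∈ U, ∀ μ ν : Fin d, partialDeriv 0 (fun q => g q μ.succ ν.succ) q
    = 2 * H q * g q μ.succ ν.succ
  smooth_rate : ContDiffOn ℝ ∞ H U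
  deriv_rate : ∀ q ∈ U, ∀ μ : Fin d, partialDeriv μ.succ H q = 0

namespace IsWarpedOn

variable {g : (Fin (d + 1) → ℝ) → Matrix (Fin (d + 1)) (Fin (d + 1)) ℝ}
  {H : (Fin (d + 1) → ℝ) → ℝ} {U : Set (Fin (d + 1) → ℝ)} {p : Fin (d + 1) → ℝ}

theorem mixed_right (hg : IsWarpedOn g H U) (hp : p ∈ U) (μ : Fin d) : g p μ.succ 0 = 0 := by
  rw [hg.symm p hp, hg.mixed p hp]

theorem time_mul_inv (hg : IsWarpedOn g H U) (hp : p ∈ U) : g p 0 0 * (g p)⁻¹ 0 0 = 1 := by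
  have := hg.sum_mul_inv hp 0 0
  simpa [Fin.sum_univ_succ, hg.mixed p hp] using this

theorem time_ne_zero (hg : IsWarpedOn g H U) (hp : p ∈ U) : g p 0 0 ≠ 0 :=
  left_ne_zero_of_mul_eq_one (hg.time_mul_inv hp)

theorem inv_mixed (hg : IsWarpedOn g H U) (hp : p ∈ U) (μ : Fin d) : (g p)⁻¹ 0 μ.succ = 0 := by
  have := hg.sum_mul_inv hp 0 μ.succ
  simpa [Fin.sum_univ_succ, hg.mixed p hp, hg.time_ne_zero hp, (Fin.succ_ne_zero μ).symm] using this

theorem inv_mixed_right (hg : IsWarpedOn g H U) (hp : p ∈ U) (μ : Fin d) :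
    (g p)⁻¹ μ.succ 0 = 0 := by
  rw [hg.inv_symm hp, hg.inv_mixed hp]

theorem space_mul_inv (hg : IsWarpedOn g H U) (hp : p ∈ U) (μ ν : Fin d) :
    ∑ σ : Fin d, g p μ.succ σ.succ * (g p)⁻¹ σ.succ ν.succ = if μ = ν then 1 else 0 := by
  have := hg.sum_mul_inv hp μ.succ ν.succ
  simpa [Fin.sum_univ_succ, hg.mixed_right hp] using this

theorem deriv_mixed (hg : IsWarpedOn g H U) (hp : p ∈ U) (i : Fin (d + 1)) (μ : Fin d) :
    partialDeriv i (fun q => g q 0 μ.succ) p = 0 :=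
  partialDeriv_eq_zero hg.isOpen hp (fun q hq => hg.mixed q hq μ) i

theorem deriv_mixed_right (hg : IsWarpedOn g H U) (hp : p ∈ U) (i : Fin (d + 1)) (μ : Fin d) :
    partialDeriv i (fun q => g q μ.succ 0) p = 0 :=
  partialDeriv_eq_zero hg.isOpen hp (fun _ hq => hg.mixed_right hq μ) i

theorem diffAt (hg : IsWarpedOn g H U) (hp : p ∈ U) {f : (Fin (d + 1) → ℝ) → ℝ}
    (hf : ContDiffOn ℝ ∞ f U) : DifferentiableAt ℝ f p :=
  differentiableAt_of_contDiffOn hg.isOpen hp hf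

theorem christoffel_time_mul (hg : IsWarpedOn g H U) (hp : p ∈ U) (i j : Fin (d + 1)) :
    christoffel g i j 0 p * g p 0 0 = (1 / 2) * (partialDeriv i (fun q => g q j 0) p
      + partialDeriv j (fun q => g q i 0) p - partialDeriv 0 (fun q => g q i j) p) := by
  rw [← hg.lower_christoffel hp i j 0, Fin.sum_univ_succ]
  simp [hg.mixed_right hp]

theorem sum_christoffel_space (hg : IsWarpedOn g H U) (hp : p ∈ U) (i j : Fin (d + 1))
    (μ : Fin d) : ∑ σ : Fin d, christoffel g i j σ.succ p * g p σ.succ μ.succ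
      = (1 / 2) * (partialDeriv i (fun q => g q j μ.succ) p
      + partialDeriv j (fun q => g q i μ.succ) p - partialDeriv μ.succ (fun q => g q i j) p) := by
  rw [← hg.lower_christoffel hp i j μ.succ, Fin.sum_univ_succ]
  simp [hg.mixed p hp]

theorem christoffel_000 (hg : IsWarpedOn g H U) (hp : p ∈ U) : christoffel g 0 0 0 p = 0 := by
  have h := hg.christoffel_time_mul hp 0 0
  rw [hg.deriv_time p hp] at h
  simpa [hg.time_ne_zero hp] using h

/-- Identifies `Γ₀μ⁰` as half the logarithmic derivative of `g₀₀`. This covector is the acceleration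
in the later arguments. -/
theorem deriv_space_time (hg : IsWarpedOn g H U) (hp : p ∈ U) (μ : Fin d) :
    partialDeriv μ.succ (fun q => g q 0 0) p = 2 * christoffel g 0 μ.succ 0 p * g p 0 0 := by
  have h := hg.christoffel_time_mul hp 0 μ.succ
  rw [hg.deriv_mixed hp, hg.deriv_mixed_right hp] at h
  linarith

theorem christoffel_s00 (hg : IsWarpedOn g H U) (hp : p ∈ U) (μ : Fin d) :
    christoffel g μ.succ 0 0 p = christoffel g 0 μ.succ 0 p := hg.christoffel_symm hp _ _ _

theorem christoffel_ss0 (hg : IsWarpedOn g H U) (hp : p ∈ U) (μ ν : Fin d) :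
    christoffel g μ.succ ν.succ 0 p = - H p / g p 0 0 * g p μ.succ ν.succ := by
  have h := hg.christoffel_time_mul hp μ.succ ν.succ
  rw [hg.deriv_mixed_right hp, hg.deriv_mixed_right hp, hg.deriv_space p hp] at h
  have := hg.time_ne_zero hp
  field_simp
  linarith

theorem christoffel_0ss (hg : IsWarpedOn g H U) (hp : p ∈ U) (μ ν : Fin d) :
    christoffel g 0 μ.succ ν.succ p = if μ = ν then H p else 0 := by
  have h (l : Fin d) : partialDeriv 0 (fun q => g q μ.succ l.succ) p
      + partialDeriv μ.succ (fun q => g q 0 l.succ) p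
      - partialDeriv l.succ (fun q => g q 0 μ.succ) p = 2 * H p * g p μ.succ l.succ := by
    rw [hg.deriv_mixed hp, hg.deriv_mixed hp, hg.deriv_space p hp]; ring
  rw [christoffel, Fin.sum_univ_succ, hg.inv_mixed_right hp]
  simp only [h]
  have e : ∑ l : Fin d, (g p)⁻¹ ν.succ l.succ * (2 * H p * g p μ.succ l.succ)
      = 2 * H p * ∑ l : Fin d, g p μ.succ l.succ * (g p)⁻¹ l.succ ν.succ := by
    rw [Finset.mul_sum]
    exact Finset.sum_congr rfl fun l _ => by rw [hg.inv_symm hp ν.succ]; ring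
  rw [e, hg.space_mul_inv hp]
  split_ifs <;> ring

theorem christoffel_s0s (hg : IsWarpedOn g H U) (hp : p ∈ U) (μ ν : Fin d) :
    christoffel g μ.succ 0 ν.succ p = if μ = ν then H p else 0 := by
  rw [hg.christoffel_symm hp, hg.christoffel_0ss hp]

theorem timeDeriv_deriv_time (hg : IsWarpedOn g H U) (hp : p ∈ U) {f : (Fin (d + 1) → ℝ) → ℝ}
    (hf : ContDiffOn ℝ ∞ f U) (hf0 : ∀ q ∈ U, partialDeriv 0 f q = 0) (i : Fin (d + 1)) :
    partialDeriv 0 (partialDeriv i f) p = 0 := by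
  rw [partialDeriv_comm hg.isOpen hp hf]
  exact partialDeriv_eq_zero hg.isOpen hp hf0 i

theorem timeDeriv_mul (hg : IsWarpedOn g H U) (hp : p ∈ U) {f h : (Fin (d + 1) → ℝ) → ℝ}
    (hf : ContDiffOn ℝ ∞ f U) (hh : ContDiffOn ℝ ∞ h U) (hf0 : partialDeriv 0 f p = 0)
    (hh0 : partialDeriv 0 h p = 0) : partialDeriv 0 (fun q => f q * h q) p = 0 := by
  rw [partialDeriv_mul 0 (hg.diffAt hp hf) (hg.diffAt hp hh), hf0, hh0]; ring

/-- The acceleration form `Γ₀μ⁰` does not depend on time. -/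
theorem timeDeriv_christoffel_0s0 (hg : IsWarpedOn g H U) (hp : p ∈ U) (μ : Fin d) :
    partialDeriv 0 (christoffel g 0 μ.succ 0) p = 0 := by
  have h := partialDeriv_congr hg.isOpen hp (fun q hq => hg.deriv_space_time hq μ) 0
  have h0 := hg.timeDeriv_deriv_time hp (hg.smooth 0 0) hg.deriv_time μ.succ
  change partialDeriv 0 (partialDeriv μ.succ fun q => g q 0 0) p = _ at h
  have hw := hg.smooth_christoffel 0 μ.succ 0
  rw [h0, partialDeriv_mul 0 ((hg.diffAt hp hw).const_mul 2) (hg.diffAt hp (hg.smooth 0 0)),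
    partialDeriv_const_mul 0 _ (hg.diffAt hp hw), hg.deriv_time p hp] at h
  have := hg.time_ne_zero hp
  simpa [this] using h.symm

theorem timeDeriv_deriv_space (hg : IsWarpedOn g H U) (hp : p ∈ U) (lam μ ν : Fin d) :
    partialDeriv 0 (partialDeriv lam.succ fun q => g q μ.succ ν.succ) p
      = 2 * H p * partialDeriv lam.succ (fun q => g q μ.succ ν.succ) p := by
  have dH := hg.diffAt hp hg.smooth_rate
  rw [partialDeriv_comm hg.isOpen hp (hg.smooth _ _),
    partialDeriv_congr hg.isOpen hp (fun q hq => hg.deriv_space q hq μ ν),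
    partialDeriv_mul _ (dH.const_mul 2) (hg.diffAt hp (hg.smooth _ _)),
    partialDeriv_const_mul _ _ dH, hg.deriv_rate p hp]
  ring

/-- The space components of the connection do not depend on time. -/
theorem timeDeriv_christoffel_sss (hg : IsWarpedOn g H U) (hp : p ∈ U) (μ ν σ : Fin d) :
    partialDeriv 0 (christoffel g μ.succ ν.succ σ.succ) p = 0 := by
  have hpd (a b c : Fin d) : DifferentiableAt ℝ (partialDeriv a.succ
      fun q => g q b.succ c.succ) p :=
    hg.diffAt hp (contDiffOn_partialDeriv hg.isOpen (hg.smooth b.succ c.succ) a.succ)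
  have hG (σ : Fin d) := hg.diffAt hp (hg.smooth_christoffel μ.succ ν.succ σ.succ)
  have hgd (a b : Fin d) := hg.diffAt hp (hg.smooth a.succ b.succ)
  -- The space metric and its space derivatives scale in time at the same rate `2H`. The rate
  -- therefore cancels from the lowered connection formula, and the inverse space block removes the
  -- remaining metric factor.
  have key (lam : Fin d) : ∑ σ : Fin d,
      partialDeriv 0 (christoffel g μ.succ ν.succ σ.succ) p * g p σ.succ lam.succ = 0 := by
    have h := partialDeriv_congr hg.isOpen hp
      (fun q hq => hg.sum_christoffel_space hq μ.succ ν.succ lam) 0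
    rw [partialDeriv_sum _ _ (fun σ _ => (hG σ).fun_mul (hgd σ lam)),
      partialDeriv_const_mul _ _ (((hpd _ _ _).fun_add (hpd _ _ _)).fun_sub (hpd _ _ _)),
      partialDeriv_sub 0 ((hpd _ _ _).fun_add (hpd _ _ _)) (hpd _ _ _),
      partialDeriv_add 0 (hpd _ _ _) (hpd _ _ _)] at h
    simp only [partialDeriv_mul 0 (hG _) (hgd _ lam), hg.deriv_space p hp] at h
    change _ = 1 / 2 * (partialDeriv 0 (partialDeriv _ _) p + partialDeriv 0 (partialDeriv _ _) p
      - partialDeriv 0 (partialDeriv _ _) p) at h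
    rw [hg.timeDeriv_deriv_space hp, hg.timeDeriv_deriv_space hp,
      hg.timeDeriv_deriv_space hp, Finset.sum_add_distrib] at h
    have e : ∑ σ : Fin d, christoffel g μ.succ ν.succ σ.succ p * (2 * H p * g p σ.succ lam.succ)
        = 2 * H p * ∑ σ : Fin d, christoffel g μ.succ ν.succ σ.succ p * g p σ.succ lam.succ := by
      rw [Finset.mul_sum]; exact Finset.sum_congr rfl fun σ _ => by ring
    rw [e, hg.sum_christoffel_space hp] at h
    linarith
  have : ∑ lam : Fin d, (∑ τ : Fin d, partialDeriv 0 (christoffel g μ.succ ν.succ τ.succ) p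
      * g p τ.succ lam.succ) * (g p)⁻¹ lam.succ σ.succ
      = partialDeriv 0 (christoffel g μ.succ ν.succ σ.succ) p := by
    simp only [Finset.sum_mul]
    rw [Finset.sum_comm]
    simp only [mul_assoc, ← Finset.mul_sum, hg.space_mul_inv hp]
    simp
  rw [← this]
  simp [key]

theorem smooth_rate_div_time (hg : IsWarpedOn g H U) :
    ContDiffOn ℝ ∞ (fun q => - H q / g q 0 0) U :=
  hg.smooth_rate.neg.div (hg.smooth 0 0) fun _ hq => hg.time_ne_zero hq

theorem deriv_rate_div_time (hg : IsWarpedOn g H U) (hp : p ∈ U) (μ : Fin d) :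
    partialDeriv μ.succ (fun q => - H q / g q 0 0) p
      = -2 * (- H p / g p 0 0) * christoffel g 0 μ.succ 0 p := by
  have h0 := hg.time_ne_zero hp
  have hN : DifferentiableAt ℝ (fun q => - H q / g q 0 0) p :=
    hg.diffAt hp hg.smooth_rate_div_time
  have h := partialDeriv_congr (f := fun q => (- H q / g q 0 0) * g q 0 0) (h := fun q => - H q)
    hg.isOpen hp (fun q hq => div_mul_cancel₀ _ (hg.time_ne_zero hq)) μ.succ
  rw [partialDeriv_mul _ hN (hg.diffAt hp (hg.smooth 0 0)), partialDeriv_neg, hg.deriv_rate p hp,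
    hg.deriv_space_time hp] at h
  refine mul_right_cancel₀ h0 ?_
  linarith

/-- The curvature components with one time index are pure trace. -/
theorem riemannUp_sss0 (hg : IsWarpedOn g H U) (hp : p ∈ U) (μ ν ρ : Fin d) :
    riemannUp g μ.succ ν.succ ρ.succ 0 p = - H p / g p 0 0 *
      (christoffel g 0 μ.succ 0 p * g p ν.succ ρ.succ
        - christoffel g 0 ν.succ 0 p * g p μ.succ ρ.succ) := by
  have hd (a b c : Fin d) : partialDeriv a.succ (christoffel g b.succ c.succ 0) p
      = -2 * (- H p / g p 0 0) * christoffel g 0 a.succ 0 p * g p b.succ c.succ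
        + - H p / g p 0 0 * partialDeriv a.succ (fun q => g q b.succ c.succ) p := by
    rw [partialDeriv_congr hg.isOpen hp (fun q hq => hg.christoffel_ss0 hq b c),
      partialDeriv_mul _ (hg.diffAt hp hg.smooth_rate_div_time) (hg.diffAt hp (hg.smooth _ _)),
      hg.deriv_rate_div_time hp]
  -- Lowering the space connection produces derivatives of the metric that cancel those in `hd`.
  -- Only terms containing `Γ₀μ⁰` survive.
  have hs (a b c : Fin d) : ∑ σ : Fin d, christoffel g a.succ b.succ σ.succ p *
      (- H p / g p 0 0 * g p c.succ σ.succ) = - H p / g p 0 0 *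
      ((1 / 2) * (partialDeriv a.succ (fun q => g q b.succ c.succ) p
      + partialDeriv b.succ (fun q => g q a.succ c.succ) p
      - partialDeriv c.succ (fun q => g q a.succ b.succ) p)) := by
    rw [← hg.sum_christoffel_space hp, Finset.mul_sum]
    exact Finset.sum_congr rfl fun σ _ => by rw [hg.symm p hp c.succ]; ring
  rw [riemannUp, Fin.sum_univ_succ, Finset.sum_sub_distrib, hd, hd]
  simp only [hg.christoffel_ss0 hp, hs, hg.christoffel_s00 hp]
  rw [hg.partialDeriv_metric_symm hp ρ.succ μ.succ ν.succ,
    hg.partialDeriv_metric_symm hp ν.succ ρ.succ μ.succ,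
    hg.partialDeriv_metric_symm hp μ.succ ρ.succ ν.succ]
  ring

theorem riemann_sss0 (hg : IsWarpedOn g H U) (hp : p ∈ U) (μ ν ρ : Fin d) :
    riemann g μ.succ ν.succ ρ.succ 0 p = - H p *
      (christoffel g 0 μ.succ 0 p * g p ν.succ ρ.succ
        - christoffel g 0 ν.succ 0 p * g p μ.succ ρ.succ) := by
  have h0 := hg.time_ne_zero hp
  rw [riemann, Fin.sum_univ_succ, hg.riemannUp_sss0 hp]
  simp only [hg.mixed p hp, zero_mul, Finset.sum_const_zero, add_zero]
  field_simp

theorem ricci_s0 (hg : IsWarpedOn g H U) (hp : p ∈ U) (μ : Fin d) :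
    ricci g μ.succ 0 p = ((d : ℝ) - 1) * H p * christoffel g 0 μ.succ 0 p := by
  have h00 : riemann g μ.succ 0 0 0 p = 0 := by
    linarith [hg.riemann_antisymm_right hp μ.succ 0 0 0]
  have h1 (ν ρ : Fin d) : (g p)⁻¹ ν.succ ρ.succ * riemann g μ.succ ν.succ 0 ρ.succ p
      = H p * christoffel g 0 μ.succ 0 p * (g p ν.succ ρ.succ * (g p)⁻¹ ρ.succ ν.succ)
        - H p * christoffel g 0 ν.succ 0 p * (g p μ.succ ρ.succ * (g p)⁻¹ ρ.succ ν.succ) := by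
    rw [hg.riemann_antisymm_right hp, hg.riemann_sss0 hp, hg.inv_symm hp ν.succ]; ring
  rw [hg.ricci_eq_sum hp]
  simp only [Fin.sum_univ_succ, h00, hg.inv_mixed hp, hg.inv_mixed_right hp, h1,
    Finset.sum_sub_distrib, ← Finset.mul_sum, hg.space_mul_inv hp]
  simp
  ring

/-- The curvature here is pure trace, and `R_{μ0}` carries the factor `d - 1 = n - 2`, which is the
denominator of the Ricci correction. The two cancel; harmonicity plays no role. -/
theorem weyl_sss0 (hg : IsWarpedOn g H U) (hd : 4 ≤ d + 1) (hp : p ∈ U) (μ ν ρ : Fin d) :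
    weyl g μ.succ ν.succ ρ.succ 0 p = 0 := by
  have hd3 : (3 : ℝ) ≤ d := by exact_mod_cast (by omega : 3 ≤ d)
  have h2 : (d : ℝ) - 1 ≠ 0 := by linarith
  rw [weyl, hg.riemann_sss0 hp, hg.ricci_s0 hp, hg.ricci_s0 hp, hg.mixed_right hp,
    hg.mixed_right hp]
  push_cast
  rw [show (d : ℝ) + 1 - 2 = d - 1 by ring]
  field_simp
  ring

theorem weyl_ss0s (hg : IsWarpedOn g H U) (hd : 4 ≤ d + 1) (hp : p ∈ U) (μ ν ρ : Fin d) :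
    weyl g μ.succ ν.succ 0 ρ.succ p = 0 := by
  rw [hg.weyl_antisymm_right hp, hg.weyl_sss0 hd hp, neg_zero]

theorem weyl_0sss (hg : IsWarpedOn g H U) (hd : 4 ≤ d + 1) (hp : p ∈ U) (μ ν ρ : Fin d) :
    weyl g 0 μ.succ ν.succ ρ.succ p = 0 := by
  rw [hg.weyl_pair_symm hp, hg.weyl_ss0s hd hp]

theorem weylUp_0 (hg : IsWarpedOn g H U) (hp : p ∈ U) (j k l : Fin (d + 1)) :
    weylUp g j k l 0 p = (g p)⁻¹ 0 0 * weyl g j k l 0 p := by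
  simp [weylUp, Fin.sum_univ_succ, hg.inv_mixed hp]

theorem weylUp_s (hg : IsWarpedOn g H U) (hp : p ∈ U) (j k l : Fin (d + 1)) (μ : Fin d) :
    weylUp g j k l μ.succ p = ∑ ν : Fin d, (g p)⁻¹ μ.succ ν.succ * weyl g j k l ν.succ p := by
  simp [weylUp, Fin.sum_univ_succ, hg.inv_mixed_right hp]

theorem weyl_eq_time_mul (hg : IsWarpedOn g H U) (hp : p ∈ U) (j k l : Fin (d + 1)) :
    weyl g j k l 0 p = g p 0 0 * weylUp g j k l 0 p := by
  rw [hg.weylUp_0 hp, ← mul_assoc, hg.time_mul_inv hp, one_mul]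

theorem weyl_00 (g : (Fin (d + 1) → ℝ) → Matrix (Fin (d + 1)) (Fin (d + 1)) ℝ)
    (j l m : Fin (d + 1)) : weyl g j j l m p = 0 := by
  linarith [IsMetricOn.weyl_antisymm_left (g := g) (p := p) j j l m]

theorem weyl_right_00 (hg : IsWarpedOn g H U) (hp : p ∈ U) (j k l : Fin (d + 1)) :
    weyl g j k l l p = 0 := by
  linarith [hg.weyl_antisymm_right hp j k l l]

/-- The coefficient of the metric involves only `c` and `H`, so it is the same for all `μ` and `ν`.
This uniformity is what the trace argument for the electric part needs. -/
theorem timeDeriv_mul_metric_add (hg : IsWarpedOn g H U) (hp : p ∈ U)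
    {f c z : (Fin (d + 1) → ℝ) → ℝ} (hc : ContDiffOn ℝ ∞ c U) (hz : ContDiffOn ℝ ∞ z U)
    (hz0 : partialDeriv 0 z p = 0) {μ ν : Fin d}
    (hf : ∀ q ∈ U, f q = c q * g q μ.succ ν.succ + z q) :
    partialDeriv 0 f p = (partialDeriv 0 c p + 2 * H p * c p) * g p μ.succ ν.succ := by
  have dg := hg.diffAt hp (hg.smooth μ.succ ν.succ)
  rw [partialDeriv_congr hg.isOpen hp hf,
    partialDeriv_add 0 ((hg.diffAt hp hc).fun_mul dg) (hg.diffAt hp hz),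
    partialDeriv_mul 0 (hg.diffAt hp hc) dg, hz0, hg.deriv_space p hp]
  ring

/-- Modulo a multiple of `g_{μν}` this component is `∂_μ w_ν + w_μ w_ν - Γ_{μν}^σ w_σ` with `w_μ =
Γ₀μ⁰`. For the spacetime metric that is the Hessian of `b` over `b`, which is free of time. -/
theorem timeDeriv_riemannUp_0ss0 (hg : IsWarpedOn g H U) (hp : p ∈ U) :
    ∃ κ : ℝ, ∀ μ ν : Fin d, partialDeriv 0 (riemannUp g 0 μ.succ ν.succ 0) p
      = κ * g p μ.succ ν.succ := by
  have hU := hg.isOpen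
  set N : (Fin (d + 1) → ℝ) → ℝ := fun q => - H q / g q 0 0 with hN
  have sN : ContDiffOn ℝ ∞ N U := hg.smooth_rate_div_time
  set c : (Fin (d + 1) → ℝ) → ℝ := fun q => -(partialDeriv 0 N q + 2 * H q * N q) + H q * N q
    with hc
  have sH := hg.smooth_rate
  have sc : ContDiffOn ℝ ∞ c U :=
    ((contDiffOn_partialDeriv hU sN 0).add ((contDiffOn_const.mul sH).mul sN)).neg.add (sH.mul sN)
  refine ⟨partialDeriv 0 c p + 2 * H p * c p, fun μ ν => ?_⟩
  have sw (μ : Fin d) := hg.smooth_christoffel 0 μ.succ 0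
  have sG (μ ν σ : Fin d) := hg.smooth_christoffel μ.succ ν.succ σ.succ
  have s1 := contDiffOn_partialDeriv hU (sw ν) μ.succ
  have s2 := (sw ν).mul (sw μ)
  have s3 : ContDiffOn ℝ ∞ (fun q => ∑ σ : Fin d, christoffel g μ.succ ν.succ σ.succ q
      * christoffel g 0 σ.succ 0 q) U := ContDiffOn.sum fun σ _ => (sG μ ν σ).mul (sw σ)
  refine hg.timeDeriv_mul_metric_add hp sc (z := fun q =>
    (partialDeriv μ.succ (christoffel g 0 ν.succ 0) q
      + christoffel g 0 ν.succ 0 q * christoffel g 0 μ.succ 0 q)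
      - ∑ σ : Fin d, christoffel g μ.succ ν.succ σ.succ q * christoffel g 0 σ.succ 0 q)
    ((s1.add s2).sub s3) ?_ ?_
  · rw [partialDeriv_sub 0 (hg.diffAt hp (s1.add s2)) (hg.diffAt hp s3),
      partialDeriv_add 0 (hg.diffAt hp s1) (hg.diffAt hp s2),
      hg.timeDeriv_mul hp (sw ν) (sw μ) (hg.timeDeriv_christoffel_0s0 hp ν)
        (hg.timeDeriv_christoffel_0s0 hp μ),
      hg.timeDeriv_deriv_time hp (sw ν) (fun q hq => hg.timeDeriv_christoffel_0s0 hq ν),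
      partialDeriv_sum _ _ (fun σ _ => hg.diffAt hp ((sG μ ν σ).mul (sw σ))),
      Finset.sum_eq_zero (fun σ _ => hg.timeDeriv_mul hp (sG μ ν σ) (sw σ)
        (hg.timeDeriv_christoffel_sss hp μ ν σ) (hg.timeDeriv_christoffel_0s0 hp σ))]
    ring
  · intro q hq
    have dN : partialDeriv 0 (christoffel g μ.succ ν.succ 0) q
        = (partialDeriv 0 N q + 2 * H q * N q) * g q μ.succ ν.succ :=
      hg.timeDeriv_mul_metric_add hq sN contDiffOn_const (partialDeriv_const 0 0)
        (fun r hr => by rw [hg.christoffel_ss0 hr]; ring)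
    rw [riemannUp, Fin.sum_univ_succ, dN, hg.christoffel_000 hq]
    simp only [hg.christoffel_s00 hq, hg.christoffel_0ss hq, hg.christoffel_ss0 hq,
      Finset.sum_sub_distrib, ite_mul, zero_mul, Finset.sum_ite_eq, Finset.mem_univ, if_true, hc,
      hN]
    ring

/-- Gauss equation: the sum is the Ricci tensor of the slice, whose connection is constant in time,
plus `(d - 1) H (-H/g₀₀) g_{μν}`. -/
theorem timeDeriv_sum_riemannUp_ssss (hg : IsWarpedOn g H U) (hp : p ∈ U) :
    ∃ κ : ℝ, ∀ μ ν : Fin d,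
      partialDeriv 0 (fun q => ∑ σ : Fin d, riemannUp g μ.succ σ.succ ν.succ σ.succ q) p
      = κ * g p μ.succ ν.succ := by
  have hU := hg.isOpen
  set c : (Fin (d + 1) → ℝ) → ℝ := fun q => ((d : ℝ) - 1) * (H q * (- H q / g q 0 0)) with hc
  have sc : ContDiffOn ℝ ∞ c U := contDiffOn_const.mul (hg.smooth_rate.mul hg.smooth_rate_div_time)
  refine ⟨partialDeriv 0 c p + 2 * H p * c p, fun μ ν => ?_⟩
  have sG (μ ν σ : Fin d) := hg.smooth_christoffel μ.succ ν.succ σ.succ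
  have zG (μ ν σ : Fin d) (q) (hq : q ∈ U) := hg.timeDeriv_christoffel_sss hq μ ν σ
  set G : Fin d → Fin d → Fin d → (Fin (d + 1) → ℝ) → ℝ := fun a b e =>
    christoffel g a.succ b.succ e.succ with hGdef
  have s1 (σ : Fin d) := contDiffOn_partialDeriv hU (sG σ ν σ) μ.succ
  have s2 (σ : Fin d) := contDiffOn_partialDeriv hU (sG μ ν σ) σ.succ
  have s3 (σ ρ : Fin d) := ((sG μ ν ρ).mul (sG σ ρ σ)).sub ((sG σ ν ρ).mul (sG μ ρ σ))
  have s4 (σ : Fin d) : ContDiffOn ℝ ∞ (fun q => ∑ ρ : Fin d,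
      (G μ ν ρ q * G σ ρ σ q - G σ ν ρ q * G μ ρ σ q)) U := ContDiffOn.sum fun ρ _ => s3 σ ρ
  have s5 (σ : Fin d) := ((s1 σ).neg.add (s2 σ)).add (s4 σ)
  refine hg.timeDeriv_mul_metric_add hp sc (z := fun q => ∑ σ : Fin d,
    (-partialDeriv μ.succ (G σ ν σ) q + partialDeriv σ.succ (G μ ν σ) q
      + ∑ ρ : Fin d, (G μ ν ρ q * G σ ρ σ q - G σ ν ρ q * G μ ρ σ q)))
    (ContDiffOn.sum fun σ _ => s5 σ) ?_ ?_
  · rw [partialDeriv_sum _ _ (fun σ _ => hg.diffAt hp (s5 σ))]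
    refine Finset.sum_eq_zero fun σ _ => ?_
    rw [partialDeriv_add 0 (hg.diffAt hp ((s1 σ).neg.add (s2 σ))) (hg.diffAt hp (s4 σ)),
      partialDeriv_add 0 (hg.diffAt hp (s1 σ).neg) (hg.diffAt hp (s2 σ)), partialDeriv_neg,
      hg.timeDeriv_deriv_time hp (sG _ _ _) (zG _ _ _),
      hg.timeDeriv_deriv_time hp (sG _ _ _) (zG _ _ _),
      partialDeriv_sum _ _ (fun ρ _ => hg.diffAt hp (s3 σ ρ)), Finset.sum_eq_zero]
    · ring
    · intro ρ _
      rw [partialDeriv_sub 0 (hg.diffAt hp ((sG _ _ _).mul (sG _ _ _)))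
          (hg.diffAt hp ((sG _ _ _).mul (sG _ _ _))),
        hg.timeDeriv_mul hp (sG _ _ _) (sG _ _ _) (zG _ _ _ p hp) (zG _ _ _ p hp),
        hg.timeDeriv_mul hp (sG _ _ _) (sG _ _ _) (zG _ _ _ p hp) (zG _ _ _ p hp), sub_zero]
  · intro q hq
    simp only [riemannUp, Fin.sum_univ_succ (n := d), hg.christoffel_ss0 hq,
      hg.christoffel_s0s hq, if_true, hc, hGdef, Finset.sum_add_distrib, Finset.sum_sub_distrib,
      Finset.sum_const, Finset.card_univ, Fintype.card_fin, nsmul_eq_mul, mul_ite, mul_zero,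
      Finset.sum_ite_eq, Finset.mem_univ]
    ring

/-- Isolates the two curvature terms with controlled time derivative. All other contributions are
multiples of `g_{μν}`. -/
theorem weylUp_0ss0_eq (hg : IsWarpedOn g H U) (hd : 4 ≤ d + 1) (hp : p ∈ U) (μ ν : Fin d) :
    weylUp g 0 μ.succ ν.succ 0 p
      = (1 - ((d : ℝ) - 1)⁻¹) * riemannUp g 0 μ.succ ν.succ 0 p
        + ((d : ℝ) - 1)⁻¹ * (∑ σ : Fin d, riemannUp g μ.succ σ.succ ν.succ σ.succ p)
        + (schoutenUp g p 0 0 - scalarCurvature g p / (2 * ((d : ℝ) * ((d : ℝ) - 1))))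
          * g p μ.succ ν.succ := by
  have hr : ricci g μ.succ ν.succ p = - riemannUp g 0 μ.succ ν.succ 0 p
      + ∑ σ : Fin d, riemannUp g μ.succ σ.succ ν.succ σ.succ p := by
    rw [ricci, Fin.sum_univ_succ, IsMetricOn.riemannUp_antisymm g μ.succ 0]
  have e1 : (1 : Matrix (Fin (d + 1)) (Fin (d + 1)) ℝ) 0 0 = 1 := Matrix.one_apply_eq 0
  have e2 : (1 : Matrix (Fin (d + 1)) (Fin (d + 1)) ℝ) μ.succ 0 = 0 :=
    Matrix.one_apply_ne (Fin.succ_ne_zero μ)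
  rw [hg.weylUp_eq hd hp, e1, e2, hg.mixed p hp]
  simp only [schouten, hr]
  push_cast
  rw [show (d : ℝ) + 1 - 2 = d - 1 by ring, show (d : ℝ) + 1 - 1 = d by ring]
  ring

/-- The time derivative of the electric part is pure trace. -/
theorem timeDeriv_weylUp_0ss0_eq (hg : IsWarpedOn g H U) (hd : 4 ≤ d + 1) (hp : p ∈ U) :
    ∃ κ : ℝ, ∀ μ ν : Fin d, partialDeriv 0 (weylUp g 0 μ.succ ν.succ 0) p
      = κ * g p μ.succ ν.succ := by
  obtain ⟨κ₁, h₁⟩ := hg.timeDeriv_riemannUp_0ss0 hp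
  obtain ⟨κ₂, h₂⟩ := hg.timeDeriv_sum_riemannUp_ssss hp
  set c : (Fin (d + 1) → ℝ) → ℝ := fun q =>
    schoutenUp g q 0 0 - scalarCurvature g q / (2 * ((d : ℝ) * ((d : ℝ) - 1))) with hc
  have sc : ContDiffOn ℝ ∞ c U :=
    (hg.smooth_schoutenUp 0 0).sub (hg.smooth_scalarCurvature.div_const _)
  refine ⟨(1 - ((d : ℝ) - 1)⁻¹) * κ₁ + ((d : ℝ) - 1)⁻¹ * κ₂
    + (partialDeriv 0 c p + 2 * H p * c p), fun μ ν => ?_⟩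
  have d1 := hg.diffAt hp (hg.smooth_riemannUp 0 μ.succ ν.succ 0)
  have d2 : DifferentiableAt ℝ
      (fun q => ∑ σ : Fin d, riemannUp g μ.succ σ.succ ν.succ σ.succ q) p :=
    hg.diffAt hp (ContDiffOn.sum fun σ _ => hg.smooth_riemannUp μ.succ σ.succ ν.succ σ.succ)
  have d3 := hg.diffAt hp (sc.mul (hg.smooth μ.succ ν.succ))
  rw [partialDeriv_congr hg.isOpen hp (fun q hq => hg.weylUp_0ss0_eq hd hq μ ν),
    partialDeriv_add 0 ((d1.const_mul _).fun_add (d2.const_mul _)) d3,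
    partialDeriv_add 0 (d1.const_mul _) (d2.const_mul _), partialDeriv_const_mul 0 _ d1,
    partialDeriv_const_mul 0 _ d2, h₁, h₂,
    hg.timeDeriv_mul_metric_add (c := c) (z := fun _ => 0) hp sc contDiffOn_const
      (partialDeriv_const 0 0) (fun q _ => by rw [add_zero])]
  ring

theorem sum_inv_mul_weylUp (hg : IsWarpedOn g H U) (hd : 4 ≤ d + 1) (hp : p ∈ U) :
    ∑ μ : Fin d, ∑ ν : Fin d, (g p)⁻¹ μ.succ ν.succ * weylUp g 0 μ.succ ν.succ 0 p = 0 := by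
  have h := hg.sum_weylUp hd hp 0 0
  rw [Fin.sum_univ_succ, hg.weylUp_0 hp, weyl_00, mul_zero, zero_add] at h
  have e (μ ν : Fin d) : weyl g μ.succ 0 0 ν.succ p
      = g p 0 0 * weylUp g 0 μ.succ ν.succ 0 p := by
    rw [IsMetricOn.weyl_antisymm_left, hg.weyl_antisymm_right hp, neg_neg, hg.weyl_eq_time_mul hp]
  simp only [hg.weylUp_s hp, e] at h
  have h' : g p 0 0 * ∑ μ : Fin d, ∑ ν : Fin d,
      (g p)⁻¹ μ.succ ν.succ * weylUp g 0 μ.succ ν.succ 0 p = 0 := by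
    rw [← h]
    simp only [Finset.mul_sum]
    exact Finset.sum_congr rfl fun μ _ => Finset.sum_congr rfl fun ν _ => by ring
  exact (mul_eq_zero.1 h').resolve_left (hg.time_ne_zero hp)

theorem timeDeriv_inv_space (hg : IsWarpedOn g H U) (hp : p ∈ U) (μ ν : Fin d) :
    partialDeriv 0 (fun q => (g q)⁻¹ μ.succ ν.succ) p = -2 * H p * (g p)⁻¹ μ.succ ν.succ := by
  rw [hg.partialDeriv_inv hp, Fin.sum_univ_succ, hg.inv_mixed hp, hg.inv_mixed_right hp]
  simp only [hg.christoffel_0ss hp, Finset.sum_add_distrib, mul_ite, mul_zero, ite_mul, zero_mul,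
    Finset.sum_ite_eq', Finset.mem_univ, if_true]
  ring

/-- The electric part, with one index raised, does not depend on time. -/
theorem timeDeriv_weylUp_0ss0 (hg : IsWarpedOn g H U) (hd : 4 ≤ d + 1) (hp : p ∈ U)
    (μ ν : Fin d) : partialDeriv 0 (weylUp g 0 μ.succ ν.succ 0) p = 0 := by
  obtain ⟨κ, hκ⟩ := hg.timeDeriv_weylUp_0ss0_eq hd hp
  have di (μ ν : Fin d) := hg.diffAt hp (hg.smooth_inv μ.succ ν.succ)
  have dW (μ ν : Fin d) := hg.diffAt hp (hg.smooth_weylUp 0 μ.succ ν.succ 0)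
  have h := partialDeriv_eq_zero hg.isOpen hp (fun q hq => hg.sum_inv_mul_weylUp hd hq) 0
  rw [partialDeriv_sum _ _ (fun μ _ => DifferentiableAt.fun_sum
    fun ν _ => (di μ ν).fun_mul (dW μ ν))] at h
  -- Differentiating the inverse metric only reproduces the trace, which is zero. Each `μ` then
  -- contributes `κ`, and the sum gives `d κ = 0`.
  have e (μ : Fin d) : partialDeriv 0 (fun q => ∑ ν : Fin d,
      (g q)⁻¹ μ.succ ν.succ * weylUp g 0 μ.succ ν.succ 0 q) p
      = -2 * H p * (∑ ν : Fin d, (g p)⁻¹ μ.succ ν.succ * weylUp g 0 μ.succ ν.succ 0 p) + κ := by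
    rw [partialDeriv_sum _ _ (fun ν _ => (di μ ν).fun_mul (dW μ ν))]
    have hκ1 : κ = κ * ∑ ν : Fin d, g p μ.succ ν.succ * (g p)⁻¹ ν.succ μ.succ := by
      rw [hg.space_mul_inv hp, if_pos rfl, mul_one]
    conv_rhs => rw [hκ1]
    rw [Finset.mul_sum, Finset.mul_sum, ← Finset.sum_add_distrib]
    refine Finset.sum_congr rfl fun ν _ => ?_
    rw [partialDeriv_mul 0 (di μ ν) (dW μ ν), hg.timeDeriv_inv_space hp, hκ,
      hg.inv_symm hp ν.succ]
    ring
  simp only [e, Finset.sum_add_distrib, ← Finset.mul_sum, hg.sum_inv_mul_weylUp hd hp,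
    Finset.sum_const, Finset.card_univ, Fintype.card_fin, nsmul_eq_mul, mul_zero, zero_add] at h
  have hd0 : (d : ℝ) ≠ 0 := by exact_mod_cast (by omega : d ≠ 0)
  rw [hκ, (mul_eq_zero.1 h).resolve_left hd0, zero_mul]

/-- Multiples of `H C_{0μν}⁰`: the time derivative gives `-2`, one from each space index. The space
divergence gives `d` from the upper index, `+1` from the first index through trace-freeness, and
`-1` from `Γ_{σν}⁰` (the sum `low`). -/
theorem divWeyl_0ss (hg : IsWarpedOn g H U) (hd : 4 ≤ d + 1) (hp : p ∈ U) (μ ν : Fin d) :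
    divWeyl g 0 μ.succ ν.succ p = ((d : ℝ) - 2) * (H p * weylUp g 0 μ.succ ν.succ 0 p) := by
  have z1 (q) (hq : q ∈ U) (a b c : Fin d) : weylUp g 0 a.succ b.succ c.succ q = 0 := by
    simp [hg.weylUp_s hq, hg.weyl_0sss hd hq]
  have z2 (a b c : Fin d) : weylUp g a.succ b.succ c.succ 0 p = 0 := by
    rw [hg.weylUp_0 hp, hg.weyl_sss0 hd hp, mul_zero]
  have z3 (l m : Fin (d + 1)) : weylUp g 0 0 l m p = 0 := by
    simp [weylUp, weyl_00]
  have z4 (k : Fin (d + 1)) : weylUp g 0 k 0 0 p = 0 := by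
    rw [hg.weylUp_0 hp, hg.weyl_right_00 hp, mul_zero]
  have z5 (σ : Fin d) : partialDeriv σ.succ (weylUp g 0 μ.succ ν.succ σ.succ) p = 0 :=
    partialDeriv_eq_zero hg.isOpen hp (fun q hq => z1 q hq μ ν σ) _
  have tr : ∑ σ : Fin d, weylUp g σ.succ μ.succ ν.succ σ.succ p
      = - weylUp g 0 μ.succ ν.succ 0 p := by
    have := hg.sum_weylUp hd hp μ.succ ν.succ
    rw [Fin.sum_univ_succ] at this
    linarith
  have low : ∑ σ : Fin d, (- H p / g p 0 0 * g p σ.succ ν.succ) * weylUp g 0 μ.succ 0 σ.succ p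
      = H p * weylUp g 0 μ.succ ν.succ 0 p := by
    have h0 := hg.time_ne_zero hp
    have e := hg.weyl_eq_sum hp 0 μ.succ 0 ν.succ
    rw [Fin.sum_univ_succ, hg.mixed_right hp, zero_mul, zero_add, hg.weyl_antisymm_right hp,
      hg.weyl_eq_time_mul hp] at e
    have e2 : ∑ σ : Fin d, (- H p / g p 0 0 * g p σ.succ ν.succ) * weylUp g 0 μ.succ 0 σ.succ p
      = - H p / g p 0 0 * ∑ σ : Fin d, g p ν.succ σ.succ * weylUp g 0 μ.succ 0 σ.succ p := by
      rw [Finset.mul_sum]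
      exact Finset.sum_congr rfl fun σ _ => by rw [hg.symm p hp ν.succ]; ring
    rw [e2, ← e]
    field_simp
  simp only [divWeyl, covDerivTensor, Fin.sum_univ_succ (n := d), z1 p hp, z2, z3, z4, z5,
    hg.timeDeriv_weylUp_0ss0 hd hp, hg.christoffel_000 hp, hg.christoffel_s0s hp,
    hg.christoffel_0ss hp, hg.christoffel_ss0 hp, mul_zero, zero_mul, sub_zero, zero_sub,
    Finset.sum_sub_distrib, Finset.sum_add_distrib, Finset.sum_neg_distrib, ite_mul, zero_add,
    Finset.sum_ite_eq, Finset.mem_univ, if_true, Finset.sum_const_zero, low,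
    Finset.sum_const, Finset.card_univ, Fintype.card_fin, nsmul_eq_mul, ← Finset.mul_sum, tr]
  ring

/-- Where the Weyl tensor is harmonic and `H² + ∂₀H ≠ 0`, the electric part vanishes. -/
theorem weylUp_0ss0_eq_zero (hg : IsWarpedOn g H U) (hd : 4 ≤ d + 1)
    (hdiv : ∀ q ∈ U, ∀ j k l, divWeyl g j k l q = 0) (hp : p ∈ U)
    (hH : H p ^ 2 + partialDeriv 0 H p ≠ 0) (μ ν : Fin d) :
    weylUp g 0 μ.succ ν.succ 0 p = 0 := by
  have hd3 : (3 : ℝ) ≤ d := by exact_mod_cast (by omega : 3 ≤ d)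
  have h (q) (hq : q ∈ U) : H q * weylUp g 0 μ.succ ν.succ 0 q = 0 := by
    have := hg.divWeyl_0ss hd hq μ ν
    rw [hdiv q hq] at this
    exact (mul_eq_zero.1 this.symm).resolve_left (by linarith)
  -- If `H` vanishes at the point then `∂₀H` does not. The identity `h` holds on all of `U`, so it
  -- may be differentiated in time.
  by_cases hH0 : H p = 0
  · have h' := partialDeriv_eq_zero hg.isOpen hp h 0
    rw [partialDeriv_mul 0 (hg.diffAt hp hg.smooth_rate) (hg.diffAt hp (hg.smooth_weylUp _ _ _ _)),
      hH0, zero_mul, add_zero] at h'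
    refine (mul_eq_zero.1 h').resolve_left fun h'' => hH ?_
    rw [hH0, h'']; ring
  · exact (mul_eq_zero.1 (h p hp)).resolve_left hH0

end IsWarpedOn
end CoordGeometry
-- Vanishing of the Weyl components where `H² + ∂₀H ≠ 0`.
namespace CoordGeometry

/-- A trace-free tensor with the symmetries of a curvature operator vanishes in dimension three. -/
theorem curvatureOperator_eq_zero_of_trace {W : Fin 3 → Fin 3 → Fin 3 → Fin 3 → ℝ}
    (h1 : ∀ a b c e, W a b c e = - W b a c e) (h2 : ∀ a b c e, W a b c e = - W a b e c)
    (h3 : ∀ b c, ∑ a, W a b c a = 0) (a b c e : Fin 3) : W a b c e = 0 := by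
  have t := h3
  simp only [Fin.sum_univ_three] at t
  have d1 (a c e : Fin 3) : W a a c e = 0 := by linarith [h1 a a c e]
  have d2 (a b c : Fin 3) : W a b c c = 0 := by linarith [h2 a b c c]
  -- The antisymmetries leave nine components, indexed by two increasing pairs, and the nine trace
  -- equations determine them.
  have s01 (c e) := h1 1 0 c e
  have s02 (c e) := h1 2 0 c e
  have s12 (c e) := h1 2 1 c e
  have r01 (a b) := h2 a b 1 0
  have r02 (a b) := h2 a b 2 0
  have r12 (a b) := h2 a b 2 1
  have t00 := t 0 0
  have t01 := t 0 1
  have t02 := t 0 2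
  have t10 := t 1 0
  have t11 := t 1 1
  have t12 := t 1 2
  have t20 := t 2 0
  have t21 := t 2 1
  have t22 := t 2 2
  simp only [d1, d2, s01, s02, s12, r01, r02, r12] at t00 t01 t02 t10 t11 t12 t20 t21 t22
  have z0101 : W 0 1 0 1 = 0 := by linarith
  have z0102 : W 0 1 0 2 = 0 := by linarith
  have z0112 : W 0 1 1 2 = 0 := by linarith
  have z0201 : W 0 2 0 1 = 0 := by linarith
  have z0202 : W 0 2 0 2 = 0 := by linarith
  have z0212 : W 0 2 1 2 = 0 := by linarith
  have z1201 : W 1 2 0 1 = 0 := by linarith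
  have z1202 : W 1 2 0 2 = 0 := by linarith
  have z1212 : W 1 2 1 2 = 0 := by linarith
  fin_cases a <;> fin_cases b <;> fin_cases c <;> fin_cases e <;>
    simp [d1, d2, s01, s02, s12, r01, r02, r12, z0101, z0102, z0112, z0201, z0202, z0212, z1201,
      z1202, z1212]

variable {d : ℕ}

namespace IsWarpedOn

variable {g : (Fin (d + 1) → ℝ) → Matrix (Fin (d + 1)) (Fin (d + 1)) ℝ}
  {H : (Fin (d + 1) → ℝ) → ℝ} {U : Set (Fin (d + 1) → ℝ)} {p : Fin (d + 1) → ℝ}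

/-- Where the Weyl tensor is harmonic and `H² + ∂₀H ≠ 0`, every Weyl component with a time index
vanishes. -/
theorem weyl_time_eq_zero (hg : IsWarpedOn g H U) (hd : 4 ≤ d + 1)
    (hdiv : ∀ q ∈ U, ∀ j k l, divWeyl g j k l q = 0) (hp : p ∈ U)
    (hH : H p ^ 2 + partialDeriv 0 H p ≠ 0) (j k l : Fin (d + 1)) : weyl g j k l 0 p = 0 := by
  have hE (μ ν : Fin d) : weyl g 0 μ.succ ν.succ 0 p = 0 := by
    rw [hg.weyl_eq_time_mul hp, hg.weylUp_0ss0_eq_zero hd hdiv hp hH, mul_zero]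
  cases l using Fin.cases with
  | zero => exact hg.weyl_right_00 hp j k 0
  | succ l =>
    cases j using Fin.cases with
    | zero =>
      cases k using Fin.cases with
      | zero => exact weyl_00 g 0 _ _
      | succ k => exact hE k l
    | succ j =>
      cases k using Fin.cases with
      | zero => rw [IsMetricOn.weyl_antisymm_left, hE, neg_zero]
      | succ k => exact hg.weyl_sss0 hd hp j k l

theorem weyl_time_left_eq_zero (hg : IsWarpedOn g H U) (hd : 4 ≤ d + 1)
    (hdiv : ∀ q ∈ U, ∀ j k l, divWeyl g j k l q = 0) (hp : p ∈ U)
    (hH : H p ^ 2 + partialDeriv 0 H p ≠ 0) (k l m : Fin (d + 1)) :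
    weyl g k l 0 m p = 0 ∧ weyl g k 0 l m p = 0 ∧ weyl g 0 k l m p = 0 := by
  have h := hg.weyl_time_eq_zero hd hdiv hp hH
  have h' (k l m : Fin (d + 1)) : weyl g k l 0 m p = 0 := by
    rw [hg.weyl_antisymm_right hp, h, neg_zero]
  exact ⟨h' k l m, by rw [hg.weyl_pair_symm hp, h], by rw [hg.weyl_pair_symm hp, h']⟩

theorem weylUp_time_eq_zero (hg : IsWarpedOn g H U) (hd : 4 ≤ d + 1)
    (hdiv : ∀ q ∈ U, ∀ j k l, divWeyl g j k l q = 0) (hp : p ∈ U)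
    (hH : H p ^ 2 + partialDeriv 0 H p ≠ 0) (k l m : Fin (d + 1)) :
    weylUp g k l m 0 p = 0 ∧ weylUp g k 0 l m p = 0 ∧ weylUp g 0 k l m p = 0 := by
  have h := hg.weyl_time_left_eq_zero hd hdiv hp hH
  refine ⟨?_, ?_, ?_⟩
  · rw [hg.weylUp_0 hp, hg.weyl_time_eq_zero hd hdiv hp hH, mul_zero]
  · simp [weylUp, h]
  · simp [weylUp, h]

/-- The acceleration form annihilates the Weyl tensor. -/
theorem sum_christoffel_mul_weylUp (hg : IsWarpedOn g H U) (hd : 4 ≤ d + 1)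
    (hdiv : ∀ q ∈ U, ∀ j k l, divWeyl g j k l q = 0) (hp : p ∈ U)
    (hH : H p ^ 2 + partialDeriv 0 H p ≠ 0) (μ ν ρ : Fin d) :
    ∑ σ : Fin d, christoffel g 0 σ.succ 0 p * weylUp g μ.succ ν.succ ρ.succ σ.succ p = 0 := by
  -- The Bianchi identity differentiates components with a time index, so their vanishing is needed
  -- on a neighbourhood: the open set where `H² + ∂₀H ≠ 0`.
  have sF : ContDiffOn ℝ ∞ (fun q => H q ^ 2 + partialDeriv 0 H q) U :=
    (hg.smooth_rate.pow 2).add (contDiffOn_partialDeriv hg.isOpen hg.smooth_rate 0)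
  have hV : IsOpen (U ∩ (fun q => H q ^ 2 + partialDeriv 0 H q) ⁻¹' {0}ᶜ) :=
    sF.continuousOn.isOpen_inter_preimage hg.isOpen isOpen_compl_singleton
  have hpV : p ∈ U ∩ (fun q => H q ^ 2 + partialDeriv 0 H q) ⁻¹' {0}ᶜ := ⟨hp, hH⟩
  have z (q) (hq : q ∈ U ∩ (fun q => H q ^ 2 + partialDeriv 0 H q) ⁻¹' {0}ᶜ) :=
    hg.weylUp_time_eq_zero hd hdiv hq.1 hq.2
  have dz (i j k l : Fin (d + 1)) : partialDeriv i (weylUp g j k l 0) p = 0 :=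
    partialDeriv_eq_zero hV hpV (fun q hq => (z q hq j k l).1) i
  -- With a time derivative and an upper time index, the only surviving term is the connection
  -- acting on the upper index, `Γ₀σ⁰ C_{μνρ}^σ`.
  have h := hg.weylUp_second_bianchi hd hp (hdiv p hp) 0 μ.succ ν.succ ρ.succ 0
  simpa [covDerivTensor, dz, z p hpV, Fin.sum_univ_succ, hg.christoffel_000 hp] using h

/-- Passes from the acceleration covector to the vector: lowering `Γ₀₀^σ` with the space metric
gives `-g₀₀ Γ₀τ⁰`. -/
theorem sum_weyl_mul_christoffel (hg : IsWarpedOn g H U) (hd : 4 ≤ d + 1)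
    (hdiv : ∀ q ∈ U, ∀ j k l, divWeyl g j k l q = 0) (hp : p ∈ U)
    (hH : H p ^ 2 + partialDeriv 0 H p ≠ 0) (j k l : Fin (d + 1)) :
    ∑ m, weyl g j k l m p * christoffel g 0 0 m p = 0 := by
  have z := hg.weyl_time_left_eq_zero hd hdiv hp hH
  have zUp := hg.weylUp_time_eq_zero hd hdiv hp hH
  cases j using Fin.cases with
  | zero => simp [z]
  | succ μ =>
  cases k using Fin.cases with
  | zero => simp [z]
  | succ ν =>
  cases l using Fin.cases with
  | zero => simp [z]
  | succ ρ =>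
  have hΓ (τ : Fin d) : ∑ σ : Fin d, christoffel g 0 0 σ.succ p * g p σ.succ τ.succ
      = - (g p 0 0 * christoffel g 0 τ.succ 0 p) := by
    rw [hg.sum_christoffel_space hp, hg.deriv_mixed hp, hg.deriv_space_time hp]; ring
  have e (σ : Fin d) : weyl g μ.succ ν.succ ρ.succ σ.succ p * christoffel g 0 0 σ.succ p
      = ∑ τ : Fin d, christoffel g 0 0 σ.succ p * g p σ.succ τ.succ
        * weylUp g μ.succ ν.succ ρ.succ τ.succ p := by
    rw [hg.weyl_eq_sum hp, Fin.sum_univ_succ, (zUp _ _ _).1, mul_zero, zero_add, Finset.sum_mul]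
    exact Finset.sum_congr rfl fun τ _ => by ring
  rw [Fin.sum_univ_succ, hg.christoffel_000 hp, mul_zero, zero_add]
  simp only [e]
  rw [Finset.sum_comm]
  simp only [← Finset.sum_mul, hΓ]
  have h := hg.sum_christoffel_mul_weylUp hd hdiv hp hH μ ν ρ
  have h2 : ∑ τ : Fin d, -(g p 0 0 * christoffel g 0 τ.succ 0 p)
      * weylUp g μ.succ ν.succ ρ.succ τ.succ p = - g p 0 0 * ∑ τ : Fin d,
      christoffel g 0 τ.succ 0 p * weylUp g μ.succ ν.succ ρ.succ τ.succ p := by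
    rw [Finset.mul_sum]; exact Finset.sum_congr rfl fun τ _ => by ring
  rw [h2, h, mul_zero]

theorem weyl_eq_zero_of_dim_four (hg : IsWarpedOn g H U) (hd : d = 3)
    (hdiv : ∀ q ∈ U, ∀ j k l, divWeyl g j k l q = 0) (hp : p ∈ U)
    (hH : H p ^ 2 + partialDeriv 0 H p ≠ 0) (j k l m : Fin (d + 1)) : weyl g j k l m p = 0 := by
  subst hd
  have z := hg.weyl_time_left_eq_zero le_rfl hdiv hp hH
  have zUp := hg.weylUp_time_eq_zero le_rfl hdiv hp hH
  -- Raising the third index too turns the metric trace into a plain sum, so no orthonormal frame is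
  -- needed. Both antisymmetries survive, and the trace over space equals the full trace because
  -- components with a time index vanish.
  have hW := curvatureOperator_eq_zero_of_trace (W := fun a b c e =>
    ∑ r : Fin 3, (g p)⁻¹ c.succ r.succ * weylUp g a.succ b.succ r.succ e.succ p)
    (fun a b c e => by
      rw [← Finset.sum_neg_distrib]
      exact Finset.sum_congr rfl fun r _ => by rw [IsMetricOn.weylUp_antisymm]; ring)
    (fun a b c e => by
      simp only [hg.weylUp_s hp, Finset.mul_sum]
      rw [Finset.sum_comm, ← Finset.sum_neg_distrib]
      refine Finset.sum_congr rfl fun r _ => ?_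
      rw [← Finset.sum_neg_distrib]
      exact Finset.sum_congr rfl fun s _ => by rw [hg.weyl_antisymm_right hp]; ring)
    (fun b c => by
      rw [Finset.sum_comm]
      refine Finset.sum_eq_zero fun r _ => ?_
      have h := hg.sum_weylUp le_rfl hp b.succ r.succ
      rw [Fin.sum_univ_succ, (zUp _ _ _).1, zero_add] at h
      rw [← Finset.mul_sum, h, mul_zero])
  have hUp (a b c e : Fin 3) : weylUp g a.succ b.succ c.succ e.succ p = 0 := by
    have h := hg.lower_raise hp (fun l => weylUp g a.succ b.succ l e.succ p) c.succ
    rw [← h]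
    refine Finset.sum_eq_zero fun r _ => ?_
    rw [Fin.sum_univ_succ]
    have z2 : weylUp g a.succ b.succ 0 e.succ p = 0 := by simp [weylUp, z]
    rw [z2]
    cases r using Fin.cases with
    | zero => simp [hg.inv_mixed hp]
    | succ r => rw [hW a b r e]; simp
  cases j using Fin.cases with
  | zero => exact (z _ _ _).2.2
  | succ a =>
  cases k using Fin.cases with
  | zero => exact (z _ _ _).2.1
  | succ b =>
  cases l using Fin.cases with
  | zero => exact (z _ _ _).1
  | succ c =>
  rw [hg.weyl_eq_sum hp, Fin.sum_univ_succ, (zUp _ _ _).1]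
  simp [hUp]

end IsWarpedOn
end CoordGeometry
-- From charts of the spacetime to warped coordinate metrics.
namespace DoublyWarpedSpacetime

variable {d : ℕ} {M : Type*} [TopologicalSpace M]
  [ChartedSpace (EuclideanSpace ℝ (Fin d)) M] [IsManifold (𝓡 d) ∞ M]

section Coordinates

variable {p : Fin (d + 1) → ℝ}

theorem spacePart_contDiff : ContDiff ℝ ∞ (spacePart : (Fin (d + 1) → ℝ) → _) := by
  rw [contDiff_euclidean]
  intro i
  exact contDiff_apply ℝ ℝ i.succ

theorem fderiv_spacePart_time :
    fderiv ℝ (spacePart : (Fin (d + 1) → ℝ) → _) p (Pi.single 0 1) = 0 := by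
  have hlin : IsLinearMap ℝ (spacePart : (Fin (d + 1) → ℝ) → EuclideanSpace ℝ (Fin d)) :=
    ⟨fun _ _ => rfl, fun _ _ => rfl⟩
  have h : HasFDerivAt (spacePart : (Fin (d + 1) → ℝ) → EuclideanSpace ℝ (Fin d))
      (LinearMap.toContinuousLinearMap hlin.mk') p :=
    (LinearMap.toContinuousLinearMap hlin.mk').hasFDerivAt
  rw [h.fderiv]
  ext i
  exact Pi.single_eq_of_ne (Fin.succ_ne_zero i) (1 : ℝ)

theorem partialDeriv_time_comp_spacePart {f : EuclideanSpace ℝ (Fin d) → ℝ}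
    (hf : DifferentiableAt ℝ f (spacePart p)) :
    CoordGeometry.partialDeriv 0 (fun q => f (spacePart q)) p = 0 := by
  have hs : DifferentiableAt ℝ (spacePart : (Fin (d + 1) → ℝ) → _) p :=
    spacePart_contDiff.contDiffAt.differentiableAt (by simp)
  rw [CoordGeometry.partialDeriv, fderiv_fun_comp p hf hs, ContinuousLinearMap.comp_apply,
    fderiv_spacePart_time, map_zero]

theorem partialDeriv_comp_time {f : ℝ → ℝ} (hf : DifferentiableAt ℝ f (p 0)) (i : Fin (d + 1)) :
    CoordGeometry.partialDeriv i (fun q => f (q 0)) p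
      = deriv f (p 0) * (Pi.single i 1 : Fin (d + 1) → ℝ) 0 := by
  have h : HasFDerivAt (fun q : Fin (d + 1) → ℝ => f (q 0)) _ p :=
    hf.hasDerivAt.comp_hasFDerivAt p
      (ContinuousLinearMap.proj (R := ℝ) (φ := fun _ : Fin (d + 1) => ℝ) 0).hasFDerivAt
  rw [CoordGeometry.partialDeriv, h.fderiv]
  rfl

end Coordinates

section Chart

variable (S : DoublyWarpedSpacetime d M) {e : OpenPartialHomeomorph M (EuclideanSpace ℝ (Fin d))}

/-- The components of the space metric in the chart `e`. -/
noncomputable def spaceMetric (e : OpenPartialHomeomorph M (EuclideanSpace ℝ (Fin d)))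
    (μ ν : Fin d) (y : EuclideanSpace ℝ (Fin d)) : ℝ :=
  S.gStar.inner (e.symm y)
    (mfderiv (𝓡 d) (𝓡 d) e.symm y (EuclideanSpace.single μ (1 : ℝ) : EuclideanSpace ℝ (Fin d)))
    (mfderiv (𝓡 d) (𝓡 d) e.symm y (EuclideanSpace.single ν (1 : ℝ) : EuclideanSpace ℝ (Fin d)))

/-- The coordinate vector field is the tangent map of the inverse chart applied to a constant vector
field, hence smooth as a section along `e.symm`. -/
theorem contMDiffOn_mfderiv_symm (he : e ∈ IsManifold.maximalAtlas (𝓡 d) ∞ M)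
    (v : EuclideanSpace ℝ (Fin d)) :
    ContMDiffOn (𝓡 d) ((𝓡 d).prod 𝓘(ℝ, EuclideanSpace ℝ (Fin d))) ∞
      (fun y => (Bundle.TotalSpace.mk' (EuclideanSpace ℝ (Fin d))
        (E := fun x : M => TangentSpace (𝓡 d) x) (e.symm y)
        (mfderiv (𝓡 d) (𝓡 d) e.symm y v))) e.target := by
  have : IsManifold (𝓡 d) 1 M := IsManifold.of_le (n := ∞) (by simp)
  have hs : ContMDiffOn (𝓡 d) (𝓡 d) ∞ e.symm e.target := contMDiffOn_symm_of_mem_maximalAtlas he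
  have ht := hs.contMDiffOn_tangentMapWithin (m := ∞) (by simp) e.open_target.uniqueMDiffOn
  have hv : ContMDiffOn (𝓡 d) ((𝓡 d).prod 𝓘(ℝ, EuclideanSpace ℝ (Fin d))) ∞
      (fun y => (⟨y, v⟩ : TangentBundle (𝓡 d) (EuclideanSpace ℝ (Fin d)))) e.target := fun y _ =>
    contMDiffWithinAt_vectorSpace_iff_contDiffWithinAt.2 contDiffWithinAt_const
  refine (ht.comp hv fun y hy => hy).congr fun y hy => ?_
  simp only [Function.comp, tangentMapWithin]
  rw [mfderivWithin_of_isOpen e.open_target hy]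

theorem contDiffOn_spaceMetric (he : e ∈ IsManifold.maximalAtlas (𝓡 d) ∞ M) (μ ν : Fin d) :
    ContDiffOn ℝ ∞ (S.spaceMetric e μ ν) e.target := by
  have hs : ContMDiffOn (𝓡 d) (𝓡 d) ∞ e.symm e.target := contMDiffOn_symm_of_mem_maximalAtlas he
  rw [← contMDiffOn_iff_contDiffOn]
  have h : ContMDiffOn (𝓡 d) ((𝓡 d).prod 𝓘(ℝ)) ∞
      (fun y => Bundle.TotalSpace.mk' ℝ (E := Bundle.Trivial M ℝ) (e.symm y)
        (S.spaceMetric e μ ν y)) e.target :=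
    ContMDiffOn.clm_bundle_apply₂ (F₁ := EuclideanSpace ℝ (Fin d))
      (F₂ := EuclideanSpace ℝ (Fin d)) (S.gStar.contMDiff.comp_contMDiffOn hs)
      (contMDiffOn_mfderiv_symm he _) (contMDiffOn_mfderiv_symm he _)
  intro y hy
  have := h y hy
  rw [Bundle.contMDiffWithinAt_totalSpace] at this
  exact this.2

theorem contDiffOn_b (he : e ∈ IsManifold.maximalAtlas (𝓡 d) ∞ M) :
    ContDiffOn ℝ ∞ (fun y => S.b (e.symm y)) e.target := by
  rw [← contMDiffOn_iff_contDiffOn]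
  exact S.contMDiff_b.comp_contMDiffOn (contMDiffOn_symm_of_mem_maximalAtlas he)

theorem g_time_time (p : Fin (d + 1) → ℝ) : S.g e p 0 0 = -(S.b (e.symm (spacePart p))) ^ 2 := by
  simp [g, metric, frame]

theorem g_time_space (p : Fin (d + 1) → ℝ) (μ : Fin d) : S.g e p 0 μ.succ = 0 := by
  simp [g, metric, frame]

theorem g_space_time (p : Fin (d + 1) → ℝ) (μ : Fin d) : S.g e p μ.succ 0 = 0 := by
  simp [g, metric, frame]

theorem g_space_space (p : Fin (d + 1) → ℝ) (μ ν : Fin d) :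
    S.g e p μ.succ ν.succ = S.a (p 0) ^ 2 * S.spaceMetric e μ ν (spacePart p) := by
  simp [g, metric, frame, spaceMetric]

theorem spaceMetric_symm (μ ν : Fin d) (y : EuclideanSpace ℝ (Fin d)) :
    S.spaceMetric e μ ν y = S.spaceMetric e ν μ y := S.gStar.symm _ _ _

/-- The quadratic form is `gStar` on the image of `v` under the differential of the inverse chart.
Positivity kills the image, and injectivity of the differential kills `v`. -/
theorem eq_zero_of_sum_spaceMetric (he : e ∈ IsManifold.maximalAtlas (𝓡 d) ∞ M)
    {y : EuclideanSpace ℝ (Fin d)} (hy : y ∈ e.target) {v : Fin d → ℝ}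
    (hv : ∑ μ, ∑ ν, v μ * v ν * S.spaceMetric e μ ν y = 0) : v = 0 := by
  set D := mfderiv (𝓡 d) (𝓡 d) e.symm y with hD
  set w : EuclideanSpace ℝ (Fin d) := ∑ μ, v μ • EuclideanSpace.single μ (1 : ℝ) with hw
  have hDw : D w = ∑ μ, v μ • D (EuclideanSpace.single μ (1 : ℝ) : EuclideanSpace ℝ (Fin d)) := by
    rw [hw]
    exact (map_sum D _ _).trans (Finset.sum_congr rfl fun μ _ => map_smul D _ _)
  have h0 : S.gStar.inner (e.symm y) (D w) (D w) = 0 := by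
    rw [hDw, ← hv]
    simp only [map_sum, map_smul, sum_apply, smul_apply,
      smul_eq_mul, Finset.mul_sum]
    rw [Finset.sum_comm]
    refine Finset.sum_congr rfl fun μ _ => Finset.sum_congr rfl fun ν _ => ?_
    rw [← mul_assoc, mul_comm (v ν)]
    rfl
  have hDw0 : D w = 0 := by
    by_contra hne
    exact (S.gStar.pos _ _ hne).ne' h0
  have hmd : e.MDifferentiable (𝓡 d) (𝓡 d) :=
    ⟨(contMDiffOn_of_mem_maximalAtlas he).mdifferentiableOn (by simp),
      (contMDiffOn_symm_of_mem_maximalAtlas he).mdifferentiableOn (by simp)⟩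
  have hinj : Function.Injective D := hmd.symm.mfderiv_injective hy
  have hw0 : w = 0 := hinj (hDw0.trans (map_zero D).symm)
  funext μ
  have := congrArg (fun z : EuclideanSpace ℝ (Fin d) => z μ) hw0
  simpa [hw, Finset.sum_apply, Pi.single_apply] using this

theorem det_g_ne_zero (he : e ∈ IsManifold.maximalAtlas (𝓡 d) ∞ M) {p : Fin (d + 1) → ℝ}
    (hp : p ∈ S.coordDomain e) : (S.g e p).det ≠ 0 := by
  intro h
  obtain ⟨v, hv0, hv⟩ := Matrix.exists_mulVec_eq_zero_iff.2 h
  have ha := S.a_pos _ hp.1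
  have hb := S.b_pos (e.symm (spacePart p))
  have h0 := congrFun hv 0
  have hs (μ : Fin d) := congrFun hv μ.succ
  simp only [Matrix.mulVec, dotProduct, Fin.sum_univ_succ, g_time_time, g_time_space,
    g_space_time, g_space_space, zero_mul, Finset.sum_const_zero, add_zero, zero_add,
    Pi.zero_apply] at h0 hs
  have hv00 : v 0 = 0 := (mul_eq_zero.1 h0).resolve_left (neg_ne_zero.2 (pow_pos hb 2).ne')
  have hvs : (fun μ : Fin d => v μ.succ) = 0 := by
    refine S.eq_zero_of_sum_spaceMetric he hp.2 (Finset.sum_eq_zero fun μ _ => ?_)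
    have h2 : S.a (p 0) ^ 2 * ∑ ν : Fin d, v μ.succ * v ν.succ
        * S.spaceMetric e μ ν (spacePart p) = v μ.succ * 0 := by
      rw [← hs μ, Finset.mul_sum, Finset.mul_sum]
      exact Finset.sum_congr rfl fun ν _ => by ring
    rw [mul_zero] at h2
    exact (mul_eq_zero.1 h2).resolve_left (pow_pos ha 2).ne'
  apply hv0
  funext i
  cases i using Fin.cases with
  | zero => exact hv00
  | succ μ => exact congrFun hvs μ

/-- The Hubble rate `a' / a` as a function of the coordinates. -/
noncomputable def hubble (p : Fin (d + 1) → ℝ) : ℝ := deriv S.a (p 0) / S.a (p 0)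

theorem isOpen_coordDomain : IsOpen (S.coordDomain e) :=
  (S.isOpen_I.preimage (continuous_apply 0)).inter
    (e.open_target.preimage spacePart_contDiff.continuous)

theorem contDiffOn_comp_time {f : ℝ → ℝ} (hf : ContDiffOn ℝ ∞ f S.I) :
    ContDiffOn ℝ ∞ (fun p : Fin (d + 1) → ℝ => f (p 0)) (S.coordDomain e) :=
  hf.comp (contDiff_apply ℝ ℝ (0 : Fin (d + 1))).contDiffOn fun _ hp => hp.1

theorem contDiffOn_comp_spacePart {f : EuclideanSpace ℝ (Fin d) → ℝ}
    (hf : ContDiffOn ℝ ∞ f e.target) :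
    ContDiffOn ℝ ∞ (fun p : Fin (d + 1) → ℝ => f (spacePart p)) (S.coordDomain e) :=
  hf.comp spacePart_contDiff.contDiffOn fun _ hp => hp.2

theorem contDiffOn_hubble : ContDiffOn ℝ ∞ (fun t => deriv S.a t / S.a t) S.I :=
  (S.contDiffOn_a.deriv_of_isOpen S.isOpen_I (by simp)).div S.contDiffOn_a
    fun t ht => (S.a_pos t ht).ne'

/-- The bridge to the coordinate theory: `-b²` is free of time, and `∂₀(a² g*) = 2 (a'/a) a² g*`
with `a'/a` free of space. -/
theorem isWarpedOn_g (he : e ∈ IsManifold.maximalAtlas (𝓡 d) ∞ M) :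
    CoordGeometry.IsWarpedOn (S.g e) S.hubble (S.coordDomain e) := by
  have dS {f : EuclideanSpace ℝ (Fin d) → ℝ} (hf : ContDiffOn ℝ ∞ f e.target)
      {q : Fin (d + 1) → ℝ} (hq : q ∈ S.coordDomain e) : DifferentiableAt ℝ f (spacePart q) :=
    (hf.contDiffAt (e.open_target.mem_nhds hq.2)).differentiableAt (by simp)
  have dT {f : ℝ → ℝ} (hf : ContDiffOn ℝ ∞ f S.I)
      {q : Fin (d + 1) → ℝ} (hq : q ∈ S.coordDomain e) : DifferentiableAt ℝ f (q 0) :=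
    (hf.contDiffAt (S.isOpen_I.mem_nhds hq.1)).differentiableAt (by simp)
  have sb2 : ContDiffOn ℝ ∞ (fun y => -(S.b (e.symm y)) ^ 2) e.target :=
    ((S.contDiffOn_b he).pow 2).neg
  have sa2 : ContDiffOn ℝ ∞ (fun t => S.a t ^ 2) S.I := S.contDiffOn_a.pow 2
  refine ⟨⟨S.isOpen_coordDomain, ?_, ?_, fun q hq => S.det_g_ne_zero he hq⟩,
    fun q _ => S.g_time_space q, ?_, ?_, S.contDiffOn_comp_time S.contDiffOn_hubble, ?_⟩
  · intro i j
    cases i using Fin.cases with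
    | zero =>
      cases j using Fin.cases with
      | zero =>
        simp only [g_time_time]
        exact S.contDiffOn_comp_spacePart sb2
      | succ ν => simp only [g_time_space]; exact contDiffOn_const
    | succ μ =>
      cases j using Fin.cases with
      | zero => simp only [g_space_time]; exact contDiffOn_const
      | succ ν =>
        simp only [g_space_space]
        exact (S.contDiffOn_comp_time sa2).mul
          (S.contDiffOn_comp_spacePart (S.contDiffOn_spaceMetric he μ ν))
  · intro q _ i j
    cases i using Fin.cases with
    | zero =>
      cases j using Fin.cases with
      | zero => rfl
      | succ ν => rw [g_time_space, g_space_time]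
    | succ μ =>
      cases j using Fin.cases with
      | zero => rw [g_time_space, g_space_time]
      | succ ν => rw [g_space_space, g_space_space, spaceMetric_symm]
  · intro q hq
    simp only [g_time_time]
    exact partialDeriv_time_comp_spacePart (dS sb2 hq)
  · intro q hq μ ν
    have ha := (S.a_pos _ hq.1).ne'
    have hd2 : deriv (fun t => S.a t ^ 2) (q 0) = 2 * S.a (q 0) * deriv S.a (q 0) := by
      rw [deriv_fun_pow (dT S.contDiffOn_a hq)]; simp
    simp only [g_space_space]
    rw [CoordGeometry.partialDeriv_mul 0
        (CoordGeometry.differentiableAt_of_contDiffOn S.isOpen_coordDomain hq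
          (S.contDiffOn_comp_time sa2))
        (CoordGeometry.differentiableAt_of_contDiffOn S.isOpen_coordDomain hq
          (S.contDiffOn_comp_spacePart (S.contDiffOn_spaceMetric he μ ν))),
      partialDeriv_time_comp_spacePart (dS (S.contDiffOn_spaceMetric he μ ν) hq),
      partialDeriv_comp_time (dT sa2 hq), hd2, Pi.single_eq_same, hubble]
    field_simp
    ring
  · intro q hq μ
    rw [show S.hubble = fun q : Fin (d + 1) → ℝ => deriv S.a (q 0) / S.a (q 0) from rfl,
      partialDeriv_comp_time (dT S.contDiffOn_hubble hq),
      Pi.single_eq_of_ne (Fin.succ_ne_zero μ).symm, mul_zero]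

theorem u_space (p : Fin (d + 1) → ℝ) (μ : Fin d) : S.u e p μ.succ = 0 := rfl

theorem contDiffOn_u_time (he : e ∈ IsManifold.maximalAtlas (𝓡 d) ∞ M) :
    ContDiffOn ℝ ∞ (fun p => S.u e p 0) (S.coordDomain e) :=
  S.contDiffOn_comp_spacePart ((S.contDiffOn_b he).inv fun _ _ => (S.b_pos _).ne')

theorem partialDeriv_u_time (he : e ∈ IsManifold.maximalAtlas (𝓡 d) ∞ M)
    {p : Fin (d + 1) → ℝ} (hp : p ∈ S.coordDomain e) :
    CoordGeometry.partialDeriv 0 (fun q => S.u e q 0) p = 0 :=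
  partialDeriv_time_comp_spacePart (f := fun y => (S.b (e.symm y))⁻¹)
    ((((S.contDiffOn_b he).inv fun _ _ => (S.b_pos _).ne').contDiffAt
      (e.open_target.mem_nhds hp.2)).differentiableAt (by simp))

theorem covDerivVec_u (p : Fin (d + 1) → ℝ) (i j : Fin (d + 1)) :
    CoordGeometry.covDerivVec (S.g e) (S.u e) i j p
      = CoordGeometry.partialDeriv i (fun q => S.u e q j) p
        + CoordGeometry.christoffel (S.g e) i 0 j p * S.u e p 0 := by
  simp [CoordGeometry.covDerivVec, Fin.sum_univ_succ, u_space]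

/-- The divergence of `u` has no time contribution, and each of the `d` space directions gives `H
u⁰`. The normalisation `n - 1` equals `d`. -/
theorem φ_eq (hd : d ≠ 0) (he : e ∈ IsManifold.maximalAtlas (𝓡 d) ∞ M)
    {p : Fin (d + 1) → ℝ} (hp : p ∈ S.coordDomain e) :
    S.φ e p = S.hubble p * S.u e p 0 := by
  have hg := S.isWarpedOn_g he
  have hd0 : (d : ℝ) ≠ 0 := by exact_mod_cast hd
  simp only [φ, CoordGeometry.expansion, Fin.sum_univ_succ, covDerivVec_u, u_space,
    S.partialDeriv_u_time he hp, hg.christoffel_000 hp, hg.christoffel_s0s hp,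
    CoordGeometry.partialDeriv_const, if_true, Finset.sum_const, Finset.card_univ,
    Fintype.card_fin, nsmul_eq_mul]
  push_cast
  rw [add_sub_cancel_right]
  field_simp
  ring

/-- Since `u⁰ = b⁻¹` is constant in time, both `φ²` and `φ̇` acquire the factor `(u⁰)²`. This turns
the invariant hypothesis into one on `H`. -/
theorem φ_sq_add_dot (hd : d ≠ 0) (he : e ∈ IsManifold.maximalAtlas (𝓡 d) ∞ M)
    {p : Fin (d + 1) → ℝ} (hp : p ∈ S.coordDomain e) :
    S.φ e p ^ 2 + CoordGeometry.dot (S.u e) (S.φ e) p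
      = (S.hubble p ^ 2 + CoordGeometry.partialDeriv 0 S.hubble p) * S.u e p 0 ^ 2 := by
  have hU := S.isOpen_coordDomain (e := e)
  have hH := (S.isWarpedOn_g he).smooth_rate
  rw [CoordGeometry.dot, Fin.sum_univ_succ,
    CoordGeometry.partialDeriv_congr hU hp (fun q hq => S.φ_eq hd he hq),
    CoordGeometry.partialDeriv_mul 0 (CoordGeometry.differentiableAt_of_contDiffOn hU hp hH)
      (CoordGeometry.differentiableAt_of_contDiffOn hU hp (S.contDiffOn_u_time he)),
    S.partialDeriv_u_time he hp, S.φ_eq hd he hp]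
  simp only [u_space, zero_mul, Finset.sum_const_zero]
  ring

theorem acceleration_u (he : e ∈ IsManifold.maximalAtlas (𝓡 d) ∞ M)
    {p : Fin (d + 1) → ℝ} (hp : p ∈ S.coordDomain e) (j : Fin (d + 1)) :
    CoordGeometry.acceleration (S.g e) (S.u e) p j
      = CoordGeometry.christoffel (S.g e) 0 0 j p * S.u e p 0 ^ 2 := by
  have h : CoordGeometry.partialDeriv 0 (fun q => S.u e q j) p = 0 := by
    cases j using Fin.cases with
    | zero => exact S.partialDeriv_u_time he hp
    | succ μ => exact CoordGeometry.partialDeriv_const 0 0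
  rw [CoordGeometry.acceleration, Fin.sum_univ_succ, covDerivVec_u, h]
  simp only [u_space, zero_mul, Finset.sum_const_zero]
  ring

end Chart

end DoublyWarpedSpacetime

/-! ### The theorem, read off from the coordinate results. -/

theorem mainTheorem5 {d : ℕ} (hn : 4 ≤ d + 1) {M : Type*} [TopologicalSpace M]
    [ChartedSpace (EuclideanSpace ℝ (Fin d)) M] [IsManifold (𝓡 d) ∞ M]
    (S : DoublyWarpedSpacetime d M) (hC : S.HarmonicWeyl)
    (e : OpenPartialHomeomorph M (EuclideanSpace ℝ (Fin d)))
    (he : e ∈ IsManifold.maximalAtlas (𝓡 d) ∞ M)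
    (p : Fin (d + 1) → ℝ) (hp : p ∈ S.coordDomain e)
    (hφ : S.φ e p ^ 2 + CoordGeometry.dot (S.u e) (S.φ e) p ≠ 0) :
    (∀ j k l, ∑ m, CoordGeometry.weyl (S.g e) j k l m p * S.u e p m = 0) ∧
    (∀ j k l, ∑ m, CoordGeometry.weyl (S.g e) j k l m p *
      CoordGeometry.acceleration (S.g e) (S.u e) p m = 0) ∧
    (d + 1 = 4 → ∀ j k l m, CoordGeometry.weyl (S.g e) j k l m p = 0) ∧
    (∀ i j, CoordGeometry.electric (S.g e) (S.u e) i j p = 0) := by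
  have hg := S.isWarpedOn_g he
  have hdiv := hC e he
  have hH : S.hubble p ^ 2 + CoordGeometry.partialDeriv 0 S.hubble p ≠ 0 := by
    rw [S.φ_sq_add_dot (by omega) he hp] at hφ
    exact left_ne_zero_of_mul hφ
  have hu (j k l : Fin (d + 1)) :
      ∑ m, CoordGeometry.weyl (S.g e) j k l m p * S.u e p m = 0 := by
    rw [Fin.sum_univ_succ, hg.weyl_time_eq_zero hn hdiv hp hH]
    simp [DoublyWarpedSpacetime.u_space]
  refine ⟨hu, fun j k l => ?_, fun h4 j k l m =>
    hg.weyl_eq_zero_of_dim_four (by omega) hdiv hp hH j k l m, fun k l => ?_⟩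
  · simp only [S.acceleration_u he hp, ← mul_assoc]
    rw [← Finset.sum_mul, hg.sum_weyl_mul_christoffel hn hdiv hp hH, zero_mul]
  · refine Finset.sum_eq_zero fun j _ => ?_
    have h : ∑ m, S.u e p j * S.u e p m * CoordGeometry.weyl (S.g e) j k l m p
        = S.u e p j * ∑ m, CoordGeometry.weyl (S.g e) j k l m p * S.u e p m := by
      rw [Finset.mul_sum]
      exact Finset.sum_congr rfl fun m _ => by ring
    rw [h, hu, mul_zero]
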